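/- Let $k\ge 1$ be an integer and $\delta\in(0,1/k)$. Let $f$ be convex on $(0,\infty)$ with $f(1)=0$, and suppose that the $f$-divergence $D_f(p,q)=\sum_{i=1}^k q(i)\,f\big(p(i)/q(i)\big)$ is ordinary, i.e. $f$ is thrice continuously differentiable on $(0,\infty)$, $\lim_{x\to\infty}|f(x)|/e^{cx}=0$ for all $c>0$, and $f''(1)\ne 0$. (Usual conventions: $f(0)=\lim_{x\to0+}f(x)$ and $0\cdot f(a/0)=a\lim_{x\to\infty}f(x)/x$; $D_f$ may be $+\infty$.) Let $\mathbb M^k_\delta$ be the set of Markov chains on $\{1,\dots,k\}$, with arbitrary initial distribution, whose transition matrix $M$ satisfies $M_{ij}\ge\delta$ for all $i,j$; let $\pi$ be the stationary distribution of $M$. An estimator $\hat M$ maps each sample sequence $x^n=(x_1,\dots,x_n)$ to a $k\times k$ transition matrix $\hat M_{x^n}$. With $X^n$ the first $n$ samples of the chain, put $$\varepsilon_n^f(\mathbb M^k_\delta)=\inf_{\hat M}\ \sup_{\mathbb M^k_\delta}\ \max_{i}\ \mathbb E\big[D_f(M(i,\cdot),\hat M_{X^n}(i,\cdot))\big],\qquad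 \tilde\varepsilon_n^f(\mathbb M^k_\delta)=\inf_{\hat M}\ \sup_{\mathbb M^k_\delta}\ \sum_{i}\pi_i\,\mathbb E\big[D_f(M(i,\cdot),\hat M_{X^n}(i,\cdot))\big].$$ Write $a_n\lesssim b_n$ if $a_n\le b_n(1+o(1))$ as $n\to\infty$, and $a_n\asymp b_n$ if $a_n\lesssim b_n$ and $b_n\lesssim a_n$. Then, with $f$, $k$, $\delta$ fixed and $n\to\infty$, $$\tilde\varepsilon_n^f(\mathbb M^k_\delta)\asymp\frac{(k-1)k f''(1)}{2n}$$ and $$(1-\delta)\frac{(k-2)f''(1)}{2n\delta}\ \lesssim\ \varepsilon_n^f(\mathbb M^k_\delta)\ \lesssim\ \frac{(k-1)f''(1)}{2n\delta}.$$ -/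

import Mathlib

open Filter Topology

/-! ### `f`-divergences -/

/-- The generator `f` of an ordinary `f`-divergence: `f` is convex on `(0,∞)` with `f 1 = 0`,
thrice continuously differentiable on `(0,∞)`, sub-exponential, and `f'' 1 ≠ 0`.
The values of `f` outside `(0,∞)` play no role. -/
structure IsOrdinary (f : ℝ → ℝ) : Prop where
  convexOn : ConvexOn ℝ (Set.Ioi 0) f
  map_one : f 1 = 0
  contDiffOn : ContDiffOn ℝ 3 f (Set.Ioi 0)
  subExponential : ∀ c : ℝ, 0 < c → Tendsto (fun x => |f x| / Real.exp (c * x)) atTop (𝓝 0)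
  deriv_two_ne_zero : deriv (deriv f) 1 ≠ 0

/-- The term `b * f (a / b)` of an `f`-divergence, for `a, b ≥ 0`, with the usual conventions
`f 0 = lim_{x → 0+} f x` and `0 * f (a / 0) = a * lim_{x → ∞} f x / x` (in particular
`0 * f (0 / 0) = 0`). For convex `f` both limits exist in `(-∞, ∞]`, so each `limsup` is a limit. -/
noncomputable def fDivTerm (f : ℝ → ℝ) (a b : ℝ) : EReal :=
  if b = 0 then (a : EReal) * limsup (fun x : ℝ => ((f x / x : ℝ) : EReal)) atTop
  else if a = 0 then (b : EReal) * limsup (fun x : ℝ => ((f x : ℝ) : EReal)) (𝓝[>] 0)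
  else ((b * f (a / b) : ℝ) : EReal)

/-- The `f`-divergence `D_f(p, q) = ∑ i, q i * f (p i / q i)` of two distributions over `k`
letters, with values in the extended reals. -/
noncomputable def fDiv (f : ℝ → ℝ) {k : ℕ} (p q : Fin k → ℝ) : EReal :=
  ∑ i, fDivTerm f (p i) (q i)

/-! ### Markov chains -/

/-- A Markov chain over `k` states: an initial distribution and a transition matrix. -/
structure MarkovChain (k : ℕ) where
  init : Fin k → ℝ
  trans : Matrix (Fin k) (Fin k) ℝ
  init_mem : init ∈ stdSimplex ℝ (Fin k)
  trans_mem : trans ∈ Matrix.rowStochastic ℝ (Fin k)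

/-- The probability `μ(x₁) M(x₁,x₂) ⋯ M(xₙ₋₁,xₙ)` that the first `n` samples of the chain are
`x₁, …, xₙ`. -/
def MarkovChain.prob {k : ℕ} (P : MarkovChain k) : (n : ℕ) → (Fin n → Fin k) → ℝ
  | 0, _ => 1
  | n + 1, x => P.init (x 0) * ∏ t : Fin n, P.trans (x t.castSucc) (x t.succ)

/-- `π` is a stationary distribution of the transition matrix `M`. -/
def IsStationaryDist {k : ℕ} (M : Matrix (Fin k) (Fin k) ℝ) (π : Fin k → ℝ) : Prop :=
  π ∈ stdSimplex ℝ (Fin k) ∧ Matrix.vecMul π M = π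

/-- The stationary distribution of the chain (a choice of one if there are several; it exists
by `exists_isStationaryDist` and is unique for positive transition matrices by
`IsStationaryDist.unique`). -/
noncomputable def MarkovChain.stationary {k : ℕ} (P : MarkovChain k) : Fin k → ℝ :=
  Classical.epsilon (IsStationaryDist P.trans)

/-- The Markov chains over `k` states all of whose transition probabilities are at least `δ`
(with an arbitrary initial distribution). -/
def chainsAtLeast (k : ℕ) (δ : ℝ) : Set (MarkovChain k) :=
  {P | ∀ i j, δ ≤ P.trans i j}

/-! ### Estimation risks -/

/-- An estimator from `n` samples maps each sample sequence to a transition matrix. -/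
abbrev Estimator (k n : ℕ) : Type :=
  (Fin n → Fin k) → Matrix.rowStochastic ℝ (Fin k)

/-- The expected loss `E_{Xⁿ ∼ P} [L(M(i,·), M̂_{Xⁿ}(i,·))]` at the state `i`. -/
noncomputable def stateRisk {k n : ℕ} (L : (Fin k → ℝ) → (Fin k → ℝ) → EReal)
    (P : MarkovChain k) (Mhat : Estimator k n) (i : Fin k) : EReal :=
  ∑ x : Fin n → Fin k, (P.prob n x : EReal) * L (P.trans i) ((Mhat x).1 i)

/-- The estimation risk: the maximum over the states of the expected loss. -/
noncomputable def maxRisk {k n : ℕ} (L : (Fin k → ℝ) → (Fin k → ℝ) → EReal)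
    (P : MarkovChain k) (Mhat : Estimator k n) : EReal :=
  ⨆ i, stateRisk L P Mhat i

/-- The stationary-weighted estimation risk: the sum over the states of the expected loss,
weighted by the stationary distribution. -/
noncomputable def weightedRisk {k n : ℕ} (L : (Fin k → ℝ) → (Fin k → ℝ) → EReal)
    (P : MarkovChain k) (Mhat : Estimator k n) : EReal :=
  ∑ i, (P.stationary i : EReal) * stateRisk L P Mhat i

/-- The minimax value of a risk over a collection of chains, for samples of length `n`. -/
noncomputable def minimax {k n : ℕ} (risk : MarkovChain k → Estimator k n → EReal)
    (C : Set (MarkovChain k)) : EReal :=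
  ⨅ Mhat : Estimator k n, ⨆ P ∈ C, risk P Mhat

/-- The minimax (worst-state) estimation risk of the collection `C` under the loss `D_f`. -/
noncomputable def minimaxMaxRisk (f : ℝ → ℝ) {k : ℕ} (C : Set (MarkovChain k)) (n : ℕ) : EReal :=
  minimax (n := n) (maxRisk (fDiv f)) C

/-- The minimax stationary-weighted estimation risk of the collection `C` under the loss `D_f`. -/
noncomputable def minimaxWeightedRisk (f : ℝ → ℝ) {k : ℕ} (C : Set (MarkovChain k)) (n : ℕ) :
    EReal :=
  minimax (n := n) (weightedRisk (fDiv f)) C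

/-! ### Asymptotic comparison -/

/-- `a ≲ b`: `a n ≤ b n * (1 + o(1))` as `n → ∞`. -/
def AsympLE (a b : ℕ → EReal) : Prop :=
  ∃ o : ℕ → ℝ, Tendsto o atTop (𝓝 0) ∧ ∀ᶠ n in atTop, a n ≤ b n * ((1 + o n : ℝ) : EReal)

/-- `a ≍ b`: both `a ≲ b` and `b ≲ a`. -/
def AsympEq (a b : ℕ → EReal) : Prop :=
  AsympLE a b ∧ AsympLE b a

/-! ### Existence and uniqueness of the stationary distribution -/

/-- A signed vector fixed by a stochastic matrix has a fixed entrywise absolute value. -/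
theorem abs_vecMul_eq {k : ℕ} {M : Matrix (Fin k) (Fin k) ℝ}
    (hM : M ∈ Matrix.rowStochastic ℝ (Fin k)) {v : Fin k → ℝ} (hv : Matrix.vecMul v M = v) :
    ∀ j, ∑ i, |v i| * M i j = |v j| := by
  have hle : ∀ j ∈ (Finset.univ : Finset (Fin k)), |v j| ≤ ∑ i, |v i| * M i j := by
    intro j _
    have h1 : v j = ∑ i, v i * M i j := by
      conv_lhs => rw [← hv]
      rfl
    rw [h1]
    refine (Finset.abs_sum_le_sum_abs _ _).trans (le_of_eq ?_)
    refine Finset.sum_congr rfl fun i _ => ?_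
    rw [abs_mul, abs_of_nonneg (Matrix.nonneg_of_mem_rowStochastic hM)]
  have hsum : ∑ j, |v j| = ∑ j, ∑ i, |v i| * M i j := by
    rw [Finset.sum_comm]
    refine Finset.sum_congr rfl fun i _ => ?_
    rw [← Finset.mul_sum, Matrix.sum_row_of_mem_rowStochastic hM, mul_one]
  intro j
  exact ((Finset.sum_eq_sum_iff_of_le hle).1 hsum j (Finset.mem_univ j)).symm

theorem exists_isStationaryDist {k : ℕ} (P : MarkovChain k) : ∃ π, IsStationaryDist P.trans π := by
  have hM := P.trans_mem
  have hdet : (P.trans - 1).det = 0 := by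
    by_contra hne
    have h1 : Matrix.mulVec (P.trans - 1) 1 = 0 := by
      rw [Matrix.sub_mulVec, Matrix.one_mulVec, Matrix.one_vecMul_of_mem_rowStochastic hM,
        sub_self]
    have h2 := Matrix.eq_zero_of_mulVec_eq_zero hne h1
    have h3 : ∑ i, P.init i = 1 := P.init_mem.2
    have h4 : ∀ i : Fin k, False := fun i => by simpa using congrFun h2 i
    have h5 : ∑ i, P.init i = 0 := Finset.sum_eq_zero fun i _ => (h4 i).elim
    linarith
  obtain ⟨v, hv0, hv⟩ := Matrix.exists_vecMul_eq_zero_iff.2 hdet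
  rw [Matrix.vecMul_sub, Matrix.vecMul_one, sub_eq_zero] at hv
  have habs := abs_vecMul_eq hM hv
  have hpos : 0 < ∑ i, |v i| := by
    obtain ⟨i, hi⟩ := Function.ne_iff.1 hv0
    exact Finset.sum_pos' (fun i _ => abs_nonneg _) ⟨i, Finset.mem_univ i, abs_pos.2 hi⟩
  refine ⟨fun i => |v i| / ∑ j, |v j|, ⟨fun i => by positivity, ?_⟩, ?_⟩
  · rw [← Finset.sum_div, div_self hpos.ne']
  · funext j
    rw [← habs j, Finset.sum_div]
    change ∑ i, |v i| / (∑ l, |v l|) * P.trans i j = _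
    exact Finset.sum_congr rfl fun i _ => by ring

theorem IsStationaryDist.unique {k : ℕ} {P : MarkovChain k} (hpos : ∀ i j, 0 < P.trans i j)
    {π₁ π₂ : Fin k → ℝ} (h₁ : IsStationaryDist P.trans π₁) (h₂ : IsStationaryDist P.trans π₂) :
    π₁ = π₂ := by
  have hv : Matrix.vecMul (π₁ - π₂) P.trans = π₁ - π₂ := by
    rw [Matrix.sub_vecMul, h₁.2, h₂.2]
  have hs : ∑ i, (π₁ - π₂) i = 0 := by
    simp only [Pi.sub_apply, Finset.sum_sub_distrib]
    rw [h₁.1.2, h₂.1.2, sub_self]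
  have habs := abs_vecMul_eq P.trans_mem hv
  set v := π₁ - π₂ with hvdef
  have hle : ∀ j, v j ≤ 0 := by
    intro i
    by_contra hi
    rw [not_le] at hi
    have hall : ∀ j, 0 < v j := by
      intro j
      have hj : ∑ l, (|v l| + v l) * P.trans l j = |v j| + v j := by
        simp only [add_mul, Finset.sum_add_distrib]
        rw [habs j]
        congr 1
        exact congrFun hv j
      have hw : 0 < |v j| + v j := by
        rw [← hj]
        refine Finset.sum_pos' (fun l _ => ?_) ⟨i, Finset.mem_univ i, ?_⟩
        · exact mul_nonneg (by linarith [neg_abs_le (v l)]) (hpos l j).le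
        · exact mul_pos (by linarith [abs_nonneg (v i)]) (hpos i j)
      by_contra hn
      rw [not_lt] at hn
      rw [abs_of_nonpos hn] at hw
      linarith
    have := Finset.sum_pos (fun j _ => hall j) ⟨i, Finset.mem_univ i⟩
    linarith
  have h0 := (Finset.sum_eq_zero_iff_of_nonpos fun j _ => hle j).1 hs
  funext j
  have := h0 j (Finset.mem_univ j)
  rw [hvdef, Pi.sub_apply] at this
  linarith

theorem MarkovChain.isStationaryDist_stationary {k : ℕ} (P : MarkovChain k) :
    IsStationaryDist P.trans P.stationary :=
  Classical.epsilon_spec (exists_isStationaryDist P)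

/-! Subtracting from `f` its tangent at `1` changes no divergence between two distributions and
leaves a nonnegative convex function equal to `f''(1)/2 * (x - 1)^2` to second order. Risks thus
reduce to χ²-type quadratic forms. State `i` is visited about `n π_i` times, so its risk should be
`(k-1) f''(1) / (2 n π_i)`: weighting by `π_i` and summing gives the factor `k`, and `π_i ≥ δ`
bounds the worst state.

Upper bound: use empirical frequencies, with the uniform row as a fallback. The deviations `N_ij -
N_i M_ij` of the transition counts are martingales with known variance and fourth moment `O(m^2)`. A
balance equation for visits, together with the contraction of sum-zero vectors
(`sum_abs_le_of_vecMul`), gives `N_i ≈ m π_i`. When all deviations are at most `σ m`, the loss is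
bounded by a quadratic form (`sum_excess_le_of_dev`); otherwise it is merely bounded, and fourth
moments make that event cost `O(m^-2)` (`exists_stateRisk_le`).

Lower bound: the van Trees inequality over a smooth prior near the matrix whose rows all equal `p`.
In a direction where the entry `(i, j)` moves at speed `1 - p_j`, the Fisher information is about `m
p_i (1 - p_j) / p_j`, so the mean square error is at least about `p_j (1 - p_j) / (m p_i)`
(`bayes_sqError_ge`); dividing by `p_j` and summing over `j` gives the factor `k - 1`. Arbitrary
estimators are covered because truncating them near `p` only lowers the nonlinear part of the loss
(`exists_fDivTerm_ge_sq`). A uniform `p` serves the weighted risk, and a `p` with one mass just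
above `δ` serves the maximal risk. -/

open MeasureTheory

/-! ### Path expectations and martingale moments -/

/-- The sum `∑ t, d (x t) (x (t + 1))` of a function of the transitions along a path. -/
def transSum {k : ℕ} (d : Fin k → Fin k → ℝ) {m : ℕ} (x : Fin (m + 1) → Fin k) : ℝ :=
  ∑ t : Fin m, d (x t.castSucc) (x t.succ)

theorem transSum_snoc {k : ℕ} (d : Fin k → Fin k → ℝ) {m : ℕ} (x : Fin (m + 1) → Fin k)
    (b : Fin k) :
    transSum d (Fin.snoc x b : Fin (m + 2) → Fin k) = transSum d x + d (x (Fin.last m)) b := by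
  unfold transSum
  rw [Fin.sum_univ_castSucc]
  congr 1
  · refine Finset.sum_congr rfl fun t _ => ?_
    rw [Fin.snoc_castSucc, ← Fin.castSucc_succ, Fin.snoc_castSucc]
  · rw [Fin.snoc_castSucc, Fin.succ_last, Fin.snoc_last]

theorem transSum_one_sample {k : ℕ} (d : Fin k → Fin k → ℝ) :
    transSum d = fun _ : Fin (0 + 1) → Fin k => 0 :=
  funext fun _ => Finset.sum_empty

theorem sum_path_snoc {k m : ℕ} (F : (Fin (m + 1) → Fin k) → ℝ) :
    ∑ x, F x = ∑ y : Fin m → Fin k, ∑ b, F (Fin.snoc y b) := by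
  rw [Finset.sum_comm, ← Fintype.sum_prod_type' (f := fun b y => F (Fin.snoc y b))]
  exact (Equiv.sum_comp (Fin.snocEquiv fun _ => Fin k) F).symm

namespace MarkovChain

variable {k : ℕ} (P : MarkovChain k)

theorem trans_nonneg (i j : Fin k) : 0 ≤ P.trans i j :=
  Matrix.nonneg_of_mem_rowStochastic P.trans_mem

theorem sum_trans (i : Fin k) : ∑ j, P.trans i j = 1 :=
  Matrix.sum_row_of_mem_rowStochastic P.trans_mem i

theorem trans_le_one (i j : Fin k) : P.trans i j ≤ 1 := by
  rw [← P.sum_trans i]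
  exact Finset.single_le_sum (fun l _ => P.trans_nonneg i l) (Finset.mem_univ j)

theorem prob_nonneg (n : ℕ) (x : Fin n → Fin k) : 0 ≤ P.prob n x := by
  cases n with
  | zero => exact zero_le_one
  | succ n =>
    exact mul_nonneg (P.init_mem.1 _) (Finset.prod_nonneg fun t _ => P.trans_nonneg _ _)

theorem prob_succ (m : ℕ) (x : Fin (m + 1) → Fin k) :
    P.prob (m + 1) x = P.init (x 0) * ∏ t : Fin m, P.trans (x t.castSucc) (x t.succ) := rfl

theorem prob_snoc (m : ℕ) (x : Fin (m + 1) → Fin k) (b : Fin k) :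
    P.prob (m + 2) (Fin.snoc x b : Fin (m + 2) → Fin k)
      = P.prob (m + 1) x * P.trans (x (Fin.last m)) b := by
  rw [prob_succ, prob_succ, Fin.prod_univ_castSucc, mul_assoc]
  congr 1
  congr 1
  · refine Finset.prod_congr rfl fun t _ => ?_
    rw [Fin.snoc_castSucc, ← Fin.castSucc_succ, Fin.snoc_castSucc]
  · rw [Fin.snoc_castSucc, Fin.succ_last, Fin.snoc_last]

/-- The expectation of a function of the first `n` samples. -/
def expect (n : ℕ) (g : (Fin n → Fin k) → ℝ) : ℝ := ∑ x, P.prob n x * g x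

variable {P} in
theorem expect_mono {n : ℕ} {g h : (Fin n → Fin k) → ℝ} (H : ∀ x, g x ≤ h x) :
    P.expect n g ≤ P.expect n h :=
  Finset.sum_le_sum fun x _ => mul_le_mul_of_nonneg_left (H x) (P.prob_nonneg n x)

theorem expect_add (n : ℕ) (g h : (Fin n → Fin k) → ℝ) :
    P.expect n (fun x => g x + h x) = P.expect n g + P.expect n h := by
  simp only [expect, mul_add, Finset.sum_add_distrib]

theorem expect_const_mul (n : ℕ) (c : ℝ) (g : (Fin n → Fin k) → ℝ) :
    P.expect n (fun x => c * g x) = c * P.expect n g := by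
  simp only [expect, Finset.mul_sum]
  exact Finset.sum_congr rfl fun x _ => by ring

theorem expect_sum {ι : Type*} (s : Finset ι) (n : ℕ) (g : ι → (Fin n → Fin k) → ℝ) :
    P.expect n (fun x => ∑ i ∈ s, g i x) = ∑ i ∈ s, P.expect n (g i) := by
  simp only [expect, Finset.mul_sum]
  exact Finset.sum_comm

theorem expect_nonneg {n : ℕ} {g : (Fin n → Fin k) → ℝ} (H : ∀ x, 0 ≤ g x) :
    0 ≤ P.expect n g :=
  Finset.sum_nonneg fun x _ => mul_nonneg (P.prob_nonneg n x) (H x)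

/-- Conditioning on all samples but the last. -/
theorem expect_succ (m : ℕ) (g : (Fin (m + 2) → Fin k) → ℝ) :
    P.expect (m + 2) g = P.expect (m + 1) fun x =>
      ∑ b, P.trans (x (Fin.last m)) b * g (Fin.snoc x b) := by
  unfold expect
  rw [sum_path_snoc]
  refine Finset.sum_congr rfl fun x _ => ?_
  rw [Finset.mul_sum]
  refine Finset.sum_congr rfl fun b _ => ?_
  rw [prob_snoc]
  ring

theorem expect_one_sample (g : (Fin 1 → Fin k) → ℝ) :
    P.expect 1 g = ∑ i, P.init i * g fun _ => i := by
  unfold expect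
  rw [← Equiv.sum_comp (Equiv.funUnique (Fin 1) (Fin k)).symm]
  refine Finset.sum_congr rfl fun i _ => ?_
  rw [prob_succ, Fin.prod_univ_zero, mul_one]
  rfl

theorem expect_one (m : ℕ) : P.expect (m + 1) (fun _ => 1) = 1 := by
  induction m with
  | zero => simpa [expect_one_sample] using P.init_mem.2
  | succ m ih =>
    rw [expect_succ]
    simpa [sum_trans] using ih

theorem expect_const (m : ℕ) (c : ℝ) : P.expect (m + 1) (fun _ => c) = c := by
  simpa [expect_one] using P.expect_const_mul (m + 1) c fun _ => 1

/-- Tower property: each increment may be replaced by its conditional mean given the past. -/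
theorem expect_transSum (d : Fin k → Fin k → ℝ) (m : ℕ) :
    P.expect (m + 1) (transSum d)
      = P.expect (m + 1) (transSum fun a _ => ∑ b, P.trans a b * d a b) := by
  induction m with
  | zero => simp [transSum_one_sample]
  | succ m ih =>
    rw [expect_succ, expect_succ]
    simp only [transSum_snoc, mul_add, Finset.sum_add_distrib, ← Finset.sum_mul, sum_trans,
      one_mul, expect_add]
    rw [ih]

variable {P} in
-- Orthogonality of martingale increments: the cross terms have conditional mean zero, so only
-- conditional variances remain.
theorem expect_transSum_sq {d : Fin k → Fin k → ℝ} (hd : ∀ a, ∑ b, P.trans a b * d a b = 0)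
    (m : ℕ) :
    P.expect (m + 1) (fun x => transSum d x ^ 2)
      = P.expect (m + 1) (transSum fun a _ => ∑ b, P.trans a b * d a b ^ 2) := by
  induction m with
  | zero => simp [transSum_one_sample]
  | succ m ih =>
    rw [expect_succ, expect_succ]
    simp only [transSum_snoc, mul_add, Finset.sum_add_distrib, ← Finset.sum_mul, sum_trans,
      one_mul, expect_add]
    rw [← ih, ← expect_add]
    congr 1
    funext x
    set a := x (Fin.last m)
    set s := transSum d x
    calc ∑ b, P.trans a b * (s + d a b) ^ 2
        = s ^ 2 * ∑ b, P.trans a b + 2 * s * ∑ b, P.trans a b * d a b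
            + ∑ b, P.trans a b * d a b ^ 2 := by
          simp only [Finset.mul_sum, ← Finset.sum_add_distrib]
          exact Finset.sum_congr rfl fun b _ => by ring
      _ = _ := by rw [sum_trans, hd]; ring

theorem expect_transSum_le {d : Fin k → Fin k → ℝ} {c : ℝ} (hd : ∀ a b, d a b ≤ c) (m : ℕ) :
    P.expect (m + 1) (transSum d) ≤ m * c := by
  refine (expect_mono (h := fun _ => m * c) fun x => ?_).trans (P.expect_const m _).le
  refine (Finset.sum_le_sum fun t _ => hd _ _).trans (le_of_eq ?_)
  simp

variable {P} in
-- Needed so that deviations of order `m` have probability `O(m^-2)`; second moments would give only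
-- `O(1/m)`, the order of the risk itself.
theorem expect_transSum_pow_four_le {d : Fin k → Fin k → ℝ}
    (hd : ∀ a, ∑ b, P.trans a b * d a b = 0) (hd1 : ∀ a b, |d a b| ≤ 1) (m : ℕ) :
    P.expect (m + 1) (fun x => transSum d x ^ 4) ≤ 11 * (m : ℝ) ^ 2 := by
  induction m with
  | zero => simp [transSum_one_sample, expect]
  | succ m ih =>
    have h2 : P.expect (m + 1) (fun x => transSum d x ^ 2) ≤ m := by
      rw [expect_transSum_sq hd]
      refine (P.expect_transSum_le (c := 1) (fun a _ => ?_) m).trans (by simp)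
      rw [← P.sum_trans a]
      refine Finset.sum_le_sum fun b _ => mul_le_of_le_one_right (P.trans_nonneg a b) ?_
      rw [← sq_abs]
      exact pow_le_one₀ (abs_nonneg _) (hd1 a b)
    rw [expect_succ]
    have key : ∀ x : Fin (m + 1) → Fin k,
        ∑ b, P.trans (x (Fin.last m)) b * transSum d (Fin.snoc x b : Fin (m + 2) → Fin k) ^ 4
          ≤ transSum d x ^ 4 + (8 * transSum d x ^ 2 + 3) := by
      intro x
      simp only [transSum_snoc]
      set a := x (Fin.last m)
      set s := transSum d x
      -- The term linear in `d a b` is kept because it averages to zero; `4 s d^3 ≤ 2 s^2 d^2 + 2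
      -- d^4` and `d^2 ≤ 1` give the rest.
      have hb : ∀ b, (s + d a b) ^ 4 ≤ (s ^ 4 + (8 * s ^ 2 + 3)) + 4 * s ^ 3 * d a b := by
        intro b
        have h := abs_le.1 (hd1 a b)
        have hq : d a b ^ 2 ≤ 1 := by nlinarith
        nlinarith [mul_nonneg (sq_nonneg (s)) (sub_nonneg.2 hq),
          mul_nonneg (sq_nonneg (s - d a b)) (sub_nonneg.2 hq), sq_nonneg (s - d a b), sq_nonneg (d a b),
          mul_nonneg (sq_nonneg (d a b)) (sub_nonneg.2 hq), mul_nonneg (sq_nonneg (d a b)) (sq_nonneg (s - d a b))]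
      calc _ ≤ ∑ b, P.trans a b * ((s ^ 4 + (8 * s ^ 2 + 3)) + 4 * s ^ 3 * d a b) :=
            Finset.sum_le_sum fun b _ => mul_le_mul_of_nonneg_left (hb b) (P.trans_nonneg a b)
        _ = (s ^ 4 + (8 * s ^ 2 + 3)) * ∑ b, P.trans a b + 4 * s ^ 3 * ∑ b, P.trans a b * d a b := by
          simp only [Finset.mul_sum, ← Finset.sum_add_distrib]
          exact Finset.sum_congr rfl fun b _ => by ring
        _ = _ := by rw [sum_trans, hd]; ring
    refine (expect_mono key).trans ?_
    rw [expect_add, expect_add, expect_const_mul, expect_const]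
    push_cast
    nlinarith

end MarkovChain

/-! ### Local behaviour of ordinary divergences -/

/-- `f` minus its tangent at `1`. It generates the same `f`-divergence as `f`. -/
noncomputable def excess (f : ℝ → ℝ) (x : ℝ) : ℝ := f x - deriv f 1 * (x - 1)

/-- Perspectives of a nonnegative convex function vanishing at `1` increase away from `a`. -/
theorem ConvexOn.mul_div_le_of_segment {g : ℝ → ℝ} (hg : ConvexOn ℝ (Set.Ioi 0) g) (h1 : g 1 = 0)
    (h0 : ∀ x, 0 < x → 0 ≤ g x) {a b t : ℝ} (ha : 0 < a) (hb : 0 < b) (ht0 : 0 ≤ t) (ht1 : t ≤ 1) :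
    ((1 - t) * a + t * b) * g (a / ((1 - t) * a + t * b)) ≤ b * g (a / b) := by
  set c := (1 - t) * a + t * b with hc
  have hcpos : 0 < c := by
    rcases eq_or_lt_of_le ht0 with h | h
    · rw [hc, ← h]; simpa using ha
    · have := mul_nonneg (sub_nonneg.2 ht1) ha.le
      have := mul_pos h hb
      linarith
  -- `a / c` is the convex combination of `1` and `a / b` with weights `(1 - t) a / c` and `t b /
  -- c`, and `g` vanishes at `1`.
  have hconv := hg.2 (Set.mem_Ioi.2 (one_pos (α := ℝ)))
    (Set.mem_Ioi.2 (div_pos ha hb))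
    (show 0 ≤ (1 - t) * a / c from div_nonneg (mul_nonneg (sub_nonneg.2 ht1) ha.le) hcpos.le)
    (show 0 ≤ t * b / c by positivity) (by rw [← add_div, ← hc, div_self hcpos.ne'])
  have he : (1 - t) * a / c * 1 + t * b / c * (a / b) = a / c := by
    field_simp
    ring
  simp only [smul_eq_mul, h1, mul_zero, zero_add] at hconv
  rw [he] at hconv
  have hg0 := h0 (a / b) (div_pos ha hb)
  calc c * g (a / c) ≤ c * (t * b / c * g (a / b)) := mul_le_mul_of_nonneg_left hconv hcpos.le
    _ = t * (b * g (a / b)) := by field_simp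
    _ ≤ 1 * (b * g (a / b)) := by gcongr
    _ = _ := one_mul _

namespace IsOrdinary

variable {f : ℝ → ℝ}

theorem differentiableAt_one (hf : IsOrdinary f) : DifferentiableAt ℝ f 1 :=
  (hf.contDiffOn.differentiableOn (by norm_num)).differentiableAt (Ioi_mem_nhds one_pos)

theorem excess_one (hf : IsOrdinary f) : excess f 1 = 0 := by
  simp [excess, hf.map_one]

theorem excess_nonneg (hf : IsOrdinary f) {x : ℝ} (hx : 0 < x) : 0 ≤ excess f x := by
  unfold excess
  rcases lt_trichotomy x 1 with h | h | h
  · have := hf.convexOn.slope_le_deriv (Set.mem_Ioi.2 hx) (Set.mem_Ioi.2 one_pos) h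
      hf.differentiableAt_one
    rw [slope_def_field, hf.map_one, div_le_iff₀ (by linarith)] at this
    linarith
  · simp [h, hf.map_one]
  · have := hf.convexOn.deriv_le_slope (Set.mem_Ioi.2 one_pos) (Set.mem_Ioi.2 hx) h
      hf.differentiableAt_one
    rw [slope_def_field, hf.map_one, le_div_iff₀ (by linarith)] at this
    linarith

theorem convexOn_excess (hf : IsOrdinary f) : ConvexOn ℝ (Set.Ioi 0) (excess f) := by
  refine ⟨convex_Ioi 0, fun x hx y hy s t hs ht hst => ?_⟩
  have := hf.convexOn.2 hx hy hs ht hst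
  simp only [excess, smul_eq_mul] at this ⊢
  have h2 : s = 1 - t := by linarith
  subst h2
  nlinarith

theorem eventually_abs_excess_sub_le (hf : IsOrdinary f) {ε : ℝ} (hε : 0 < ε) :
    ∀ᶠ x in 𝓝 1, |excess f x - deriv (deriv f) 1 / 2 * (x - 1) ^ 2| ≤ ε * (x - 1) ^ 2 := by
  have h := taylor_isLittleO (n := 2) (convex_Ioi (0 : ℝ)) (Set.mem_Ioi.2 one_pos)
    (hf.contDiffOn.of_le (by norm_num))
  rw [IsOpen.nhdsWithin_eq isOpen_Ioi (Set.mem_Ioi.2 one_pos)] at h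
  filter_upwards [h.def hε] with x hx
  have h1 : iteratedDerivWithin 1 f (Set.Ioi 0) 1 = deriv f 1 := by
    rw [iteratedDerivWithin_of_isOpen isOpen_Ioi (Set.mem_Ioi.2 one_pos), iteratedDeriv_one]
  have h2 : iteratedDerivWithin 2 f (Set.Ioi 0) 1 = deriv (deriv f) 1 := by
    rw [iteratedDerivWithin_of_isOpen isOpen_Ioi (Set.mem_Ioi.2 one_pos), iteratedDeriv_succ,
      iteratedDeriv_one]
  rw [taylorWithinEval_succ, taylorWithinEval_succ, taylor_within_zero_eval] at hx
  simp only [zero_add, Nat.reduceAdd, h1, h2, hf.map_one, smul_eq_mul, Real.norm_eq_abs,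
    abs_of_nonneg (sq_nonneg (x - 1))] at hx
  refine le_trans (le_of_eq ?_) hx
  congr 1
  simp [excess, Nat.factorial]
  ring

theorem deriv_two_pos (hf : IsOrdinary f) : 0 < deriv (deriv f) 1 := by
  refine lt_of_le_of_ne ?_ hf.deriv_two_ne_zero.symm
  by_contra! hneg
  -- With this error the excess would be at most `f''(1)/4 * (x - 1)^2 < 0` near `1`.
  obtain ⟨ρ, hρ, h⟩ := Metric.eventually_nhds_iff.1
    (hf.eventually_abs_excess_sub_le (ε := -deriv (deriv f) 1 / 4) (by linarith))
  have h1 := h (y := 1 + ρ / 2) (by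
    rw [Real.dist_eq, add_sub_cancel_left, abs_of_pos (by linarith)]; linarith)
  have h2 := hf.excess_nonneg (x := 1 + ρ / 2) (by linarith)
  have h3 := (abs_le.1 h1).2
  have h4 : 0 < (1 + ρ / 2 - 1) ^ 2 := by
    rw [add_sub_cancel_left]
    positivity
  nlinarith

theorem exists_excess_bounds (hf : IsOrdinary f) {ε : ℝ} (hε : 0 < ε) : ∃ ρ > 0, ∀ x, |x - 1| < ρ →
    (1 - ε) * (deriv (deriv f) 1 / 2) * (x - 1) ^ 2 ≤ excess f x ∧
    excess f x ≤ (1 + ε) * (deriv (deriv f) 1 / 2) * (x - 1) ^ 2 := by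
  have hpos := hf.deriv_two_pos
  obtain ⟨ρ, hρ, h⟩ := Metric.eventually_nhds_iff.1
    (hf.eventually_abs_excess_sub_le (ε := ε * (deriv (deriv f) 1 / 2)) (by positivity))
  refine ⟨ρ, hρ, fun x hx => ?_⟩
  have := abs_le.1 (h (y := x) hx)
  constructor <;> nlinarith [this.1, this.2]

theorem _root_.fDivTerm_of_pos {a b : ℝ} (ha : 0 < a) (hb : 0 < b) :
    fDivTerm f a b = ((deriv f 1 * (a - b) + b * excess f (a / b) : ℝ) : EReal) := by
  rw [fDivTerm, if_neg hb.ne', if_neg ha.ne']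
  congr 1
  unfold excess
  field_simp
  ring

/-- Moving `b` towards `a` lowers the perspective of the excess. The linear term keeps the original
`b`, so that it still cancels when summed over the letters. For `b = 0` the bound is applied at `a /
x` and `x → ∞`. -/
theorem fDivTerm_ge_of_excess (hf : IsOrdinary f) {a b c : ℝ} (ha : 0 < a) (hb : 0 ≤ b)
    {t : ℝ} (ht0 : 0 ≤ t) (ht1 : t ≤ 1) (hc : c = (1 - t) * a + t * b) (hc0 : 0 < c) :
    ((deriv f 1 * (a - b) + c * excess f (a / c) : ℝ) : EReal) ≤ fDivTerm f a b := by
  rcases eq_or_lt_of_le hb with h | h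
  · subst h
    rw [fDivTerm, if_pos rfl]
    set l := c * excess f (a / c)
    have htend : Tendsto (fun x : ℝ => (((l / a + deriv f 1 * (1 - x⁻¹) : ℝ)) : EReal)) atTop
        (𝓝 ((l / a + deriv f 1 * (1 - 0) : ℝ) : EReal)) := by
      refine (continuous_coe_real_ereal.tendsto _).comp ?_
      exact ((tendsto_inv_atTop_zero.const_sub 1).const_mul _).const_add _
    have hle : ((l / a + deriv f 1 * (1 - 0) : ℝ) : EReal)
        ≤ limsup (fun x : ℝ => ((f x / x : ℝ) : EReal)) atTop := by
      rw [← htend.limsup_eq]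
      refine limsup_le_limsup ?_
      filter_upwards [eventually_gt_atTop (a / c), eventually_gt_atTop 0] with x hx hx0
      refine EReal.coe_le_coe_iff.2 ?_
      have hxc : a / x < c := by
        rw [div_lt_iff₀ hx0]
        rwa [div_lt_iff₀ hc0, mul_comm] at hx
      have hca : c ≤ a := by nlinarith
      have hax : a / x < a := hxc.trans_le hca
      have key := hf.convexOn_excess.mul_div_le_of_segment hf.excess_one
        (fun x hx => hf.excess_nonneg hx) (b := a / x) (t := (a - c) / (a - a / x)) ha
        (by positivity) (div_nonneg (by linarith) (by linarith))
        ((div_le_one (by linarith)).2 (by linarith))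
      have hcc : (1 - (a - c) / (a - a / x)) * a + (a - c) / (a - a / x) * (a / x) = c := by
        have hne : a - a / x ≠ 0 := by linarith
        linear_combination -(div_mul_cancel₀ (a - c) hne)
      rw [hcc, div_div_cancel₀ ha.ne'] at key
      have h2 : l / a ≤ excess f x / x := by
        rw [div_le_div_iff₀ ha hx0]
        have : a / x * excess f x = excess f x * a / x := by ring
        rw [this, le_div_iff₀ hx0] at key
        exact key
      refine (add_le_add_left h2 _).trans (le_of_eq ?_)
      unfold excess
      field_simp
      ring
    calc _ = (a : EReal) * ((l / a + deriv f 1 * (1 - 0) : ℝ) : EReal) := by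
          rw [← EReal.coe_mul]
          congr 1
          field_simp
          ring
      _ ≤ _ := mul_le_mul_of_nonneg_left hle (EReal.coe_nonneg.2 ha.le)
  · rw [fDivTerm_of_pos ha h, EReal.coe_le_coe_iff, hc]
    refine add_le_add_right ?_ _
    exact hf.convexOn_excess.mul_div_le_of_segment hf.excess_one
      (fun x hx => hf.excess_nonneg hx) ha h ht0 ht1

/-- The truncation of `b` to relative distance `η` from `p`. -/
noncomputable def _root_.truncate (η p b : ℝ) : ℝ := max ((1 - η) * p) (min ((1 + η) * p) b)

theorem _root_.le_truncate (η p b : ℝ) : (1 - η) * p ≤ truncate η p b := le_max_left _ _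

theorem _root_.truncate_le {η p : ℝ} (hη : 0 ≤ η) (hp : 0 ≤ p) (b : ℝ) :
    truncate η p b ≤ (1 + η) * p :=
  max_le (by nlinarith) (min_le_left _ _)

/-- Truncation projects onto an interval that contains `a`, so its value lies between `a` and `b`.
-/
theorem _root_.exists_truncate_eq {η p a : ℝ} (h1 : (1 - η) * p ≤ a) (h2 : a ≤ (1 + η) * p)
    (b : ℝ) : ∃ t, 0 ≤ t ∧ t ≤ 1 ∧ truncate η p b = (1 - t) * a + t * b := by
  have hmem : truncate η p b ∈ segment ℝ a b := by
    rw [segment_eq_uIcc, Set.mem_uIcc, truncate]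
    grind
  obtain ⟨s, t, hs, ht, hst, h⟩ := hmem
  refine ⟨t, ht, by linarith, ?_⟩
  rw [← h, smul_eq_mul, smul_eq_mul, ← hst]
  ring

/-- A quadratic lower bound valid for every estimate `b`, however far from `p`: the Taylor bound is
needed only at the truncated value. -/
theorem exists_fDivTerm_ge_sq (hf : IsOrdinary f) {ε : ℝ} (hε : 0 < ε) (hε1 : ε < 1) :
    ∃ η₀ > 0, η₀ < 1 ∧ ∀ η, 0 < η → η ≤ η₀ →
    ∀ p a b : ℝ, 0 < p → (1 - η) * p ≤ a → a ≤ (1 + η) * p → 0 ≤ b →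
    ((deriv f 1 * (a - b) + (1 - ε) * (deriv (deriv f) 1 / (2 * p)) * (a - truncate η p b) ^ 2 : ℝ)
      : EReal) ≤ fDivTerm f a b := by
  obtain ⟨ρ, hρ, hlow⟩ := hf.exists_excess_bounds (half_pos hε)
  have hF := hf.deriv_two_pos
  -- `1 / 2` gives `c ≥ p / 2`, whence `|a - c| ≤ 2 η p ≤ 4 η c < ρ c` from `ρ / 5`; `ε / 2` gives
  -- `(1 - ε) (1 + η) ≤ 1 - ε / 2`.
  refine ⟨min (ε / 2) (min (1 / 2) (ρ / 5)), by positivity, ?_, ?_⟩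
  · exact (min_le_right _ _).trans_lt ((min_le_left _ _).trans_lt (by norm_num))
  intro η hη0 hη p a b hp ha1 ha2 hb
  rw [le_min_iff, le_min_iff] at hη
  obtain ⟨hη1, hη2, hη3⟩ := hη
  obtain ⟨t, ht0, ht1, hc⟩ := exists_truncate_eq ha1 ha2 b
  have hc1 := le_truncate η p b
  have hc2 := truncate_le hη0.le hp.le b
  have hp2 : 1 / 2 * p ≤ (1 - η) * p := by gcongr; linarith
  set c := truncate η p b
  have hc0 : 0 < c := by linarith
  have ha : 0 < a := by linarith
  refine le_trans (EReal.coe_le_coe_iff.2 (add_le_add_right ?_ _))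
    (hf.fDivTerm_ge_of_excess ha hb ht0 ht1 hc hc0)
  have hdist : |a / c - 1| < ρ := by
    have : a / c - 1 = (a - c) / c := by field_simp
    rw [this, abs_div, abs_of_pos hc0, div_lt_iff₀ hc0, abs_lt]
    constructor <;> nlinarith
  have h := (hlow _ hdist).1
  calc (1 - ε) * (deriv (deriv f) 1 / (2 * p)) * (a - c) ^ 2
      = (1 - ε) * (1 + η) * (deriv (deriv f) 1 / 2 * (a - c) ^ 2 * ((1 + η) * p)⁻¹) := by
        field_simp
    _ ≤ (1 - ε / 2) * (deriv (deriv f) 1 / 2 * (a - c) ^ 2 * c⁻¹) := by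
        gcongr
        · linarith
        · nlinarith
    _ = c * ((1 - ε / 2) * (deriv (deriv f) 1 / 2) * (a / c - 1) ^ 2) := by
        field_simp
    _ ≤ c * excess f (a / c) := mul_le_mul_of_nonneg_left h hc0.le

end IsOrdinary

/-! ### Smooth priors and the perturbed family of chains -/

theorem integral_fderiv_apply_eq_zero {E : Type*} [NormedAddCommGroup E] [NormedSpace ℝ E]
    [FiniteDimensional ℝ E] [MeasurableSpace E] [BorelSpace E] (μ : Measure E)
    [μ.IsAddHaarMeasure] {F : E → ℝ} (hF : ContDiff ℝ 1 F) (hc : HasCompactSupport F) (v : E) :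
    ∫ θ, fderiv ℝ F θ v ∂μ = 0 := by
  have hcont : Continuous fun θ => fderiv ℝ F θ v :=
    (hF.continuous_fderiv one_ne_zero).clm_apply continuous_const
  have h := integral_smul_fderiv_eq_neg_fderiv_smul_of_integrable (μ := μ) (f := fun _ : E => (1 : ℝ))
    (g := F) (v := v) (by simp)
    (by simpa using hcont.integrable_of_hasCompactSupport (hc.fderiv_apply (𝕜 := ℝ) v))
    (by simpa using hF.continuous.integrable_of_hasCompactSupport hc)
    (fun x _ => differentiableAt_const _) (fun x _ => hF.differentiable one_ne_zero x)
  simpa using h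

/-- The prior density is `ρ ^ 2`; its Fisher information is then `4 ∫ (∂ρ)^2`, with no division by a
vanishing density. -/
theorem exists_smooth_sqrt_density (E : Type*) [NormedAddCommGroup E] [NormedSpace ℝ E]
    [FiniteDimensional ℝ E] [MeasurableSpace E] [BorelSpace E] (μ : Measure E)
    [μ.IsAddHaarMeasure] {r : ℝ} (hr : 0 < r) :
    ∃ ρ : E → ℝ, ContDiff ℝ 1 ρ ∧ HasCompactSupport ρ ∧ (∀ θ, ρ θ ≠ 0 → ‖θ‖ < r) ∧
      ∫ θ, ρ θ ^ 2 ∂μ = 1 := by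
  let φ : ContDiffBump (0 : E) := ⟨r / 2, r, by positivity, by linarith⟩
  have hsq : Continuous fun θ => φ θ ^ 2 := φ.continuous.pow 2
  have hcs : HasCompactSupport fun θ => φ θ ^ 2 :=
    φ.hasCompactSupport.comp_left (g := fun y : ℝ => y ^ 2) (by simp)
  have hZ : 0 < ∫ θ, φ θ ^ 2 ∂μ := by
    refine hsq.integral_pos_of_hasCompactSupport_nonneg_nonzero hcs (fun θ => sq_nonneg _)
      (x := 0) ?_
    have : φ (0 : E) = 1 := φ.one_of_mem_closedBall (Metric.mem_closedBall_self φ.rIn_pos.le)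
    simp [this]
  refine ⟨fun θ => (√(∫ θ, φ θ ^ 2 ∂μ))⁻¹ * φ θ, contDiff_const.mul φ.contDiff,
    φ.hasCompactSupport.mul_left, fun θ h => ?_, ?_⟩
  · have : θ ∈ Function.support φ := right_ne_zero_of_mul h
    rw [φ.support_eq] at this
    simpa using this
  · simp only [mul_pow, inv_pow, Real.sq_sqrt hZ.le]
    rw [integral_const_mul, inv_mul_cancel₀ hZ.ne']

/-- A transition matrix near the one whose rows all equal `p`; its rows sum to `1`. -/
def perturb {k : ℕ} (p : Fin k → ℝ) (θ : Fin k → Fin k → ℝ) : Matrix (Fin k) (Fin k) ℝ :=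
  fun a b => p b + θ a b - p b * ∑ c, θ a c

/-- The derivative of `perturb p` in the direction of the coordinate `(i, j)`. -/
def perturbDir {k : ℕ} (p : Fin k → ℝ) (i j a b : Fin k) : ℝ :=
  if a = i then (if b = j then 1 else 0) - p b else 0

/-- The likelihood of a path started from `p` under `perturb p θ`. -/
def pathLik {k : ℕ} (p : Fin k → ℝ) {m : ℕ} (x : Fin (m + 1) → Fin k) (θ : Fin k → Fin k → ℝ) : ℝ :=
  p (x 0) * ∏ t : Fin m, perturb p θ (x t.castSucc) (x t.succ)

/-- The coordinate direction `(i, j)` in the space of square arrays. -/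
def coordDir {k : ℕ} (i j : Fin k) : Fin k → Fin k → ℝ := Pi.single i (Pi.single j 1)

section perturb

variable {k : ℕ} {p : Fin k → ℝ}

theorem perturb_add_smul (i j a b : Fin k) (θ : Fin k → Fin k → ℝ) (s : ℝ) :
    perturb p (θ + s • coordDir i j) a b = perturb p θ a b + s * perturbDir p i j a b := by
  unfold perturb perturbDir coordDir
  by_cases h : a = i
  · subst h
    simp only [Pi.add_apply, Pi.smul_apply, Pi.single_eq_same, smul_eq_mul, Finset.sum_add_distrib,
      ← Finset.mul_sum, Pi.single_apply]
    simp
    split_ifs <;> ring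
  · simp [h]

theorem contDiff_perturb (a b : Fin k) : ContDiff ℝ 1 fun θ => perturb p θ a b := by
  unfold perturb
  fun_prop

theorem contDiff_pathLik {m : ℕ} (x : Fin (m + 1) → Fin k) : ContDiff ℝ 1 (pathLik p x) :=
  contDiff_const.mul (contDiff_prod fun _ _ => contDiff_perturb _ _)

theorem sum_perturb (hp : ∑ b, p b = 1) (θ : Fin k → Fin k → ℝ) (a : Fin k) :
    ∑ b, perturb p θ a b = 1 := by
  simp only [perturb, Finset.sum_sub_distrib, Finset.sum_add_distrib, ← Finset.sum_mul, hp]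
  ring

theorem sum_perturbDir (hp : ∑ b, p b = 1) (i j a : Fin k) : ∑ b, perturbDir p i j a b = 0 := by
  unfold perturbDir
  split_ifs <;> simp [hp]

theorem abs_perturb_sub_le (hp : p ∈ stdSimplex ℝ (Fin k)) {θ : Fin k → Fin k → ℝ} {r : ℝ}
    (hθ : ‖θ‖ ≤ r) (a b : Fin k) : |perturb p θ a b - p b| ≤ (k + 1) * r := by
  have h : ∀ c, |θ a c| ≤ r := fun c =>
    ((norm_le_pi_norm (θ a) c).trans (norm_le_pi_norm θ a)).trans hθ
  have hb : p b ≤ 1 := by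
    rw [← hp.2]
    exact Finset.single_le_sum (fun c _ => hp.1 c) (Finset.mem_univ b)
  have hs : |∑ c, θ a c| ≤ k * r := by
    refine (Finset.abs_sum_le_sum_abs _ _).trans ((Finset.sum_le_sum fun c _ => h c).trans ?_)
    simp
  have : perturb p θ a b - p b = θ a b - p b * ∑ c, θ a c := by
    unfold perturb
    ring
  rw [this]
  refine (abs_sub _ _).trans ?_
  rw [abs_mul, abs_of_nonneg (hp.1 b)]
  nlinarith [h b, abs_nonneg (∑ c, θ a c), hp.1 b]

theorem fderiv_perturb (i j a b : Fin k) (θ : Fin k → Fin k → ℝ) :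
    fderiv ℝ (fun θ => perturb p θ a b) θ (coordDir i j) = perturbDir p i j a b := by
  rw [← ((contDiff_perturb a b).differentiable one_ne_zero θ).lineDeriv_eq_fderiv, lineDeriv]
  simp only [perturb_add_smul]
  simp

/-- Logarithmic differentiation: the score of a path is a sum over its transitions, so the
martingale moment identities apply to it. -/
theorem fderiv_pathLik (i j : Fin k) {m : ℕ} (x : Fin (m + 1) → Fin k) (θ : Fin k → Fin k → ℝ)
    (hθ : ∀ a b, perturb p θ a b ≠ 0) :
    fderiv ℝ (pathLik p x) θ (coordDir i j)
      = pathLik p x θ * transSum (fun a b => perturbDir p i j a b / perturb p θ a b) x := by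
  rw [← ((contDiff_pathLik x).differentiable one_ne_zero θ).lineDeriv_eq_fderiv]
  refine HasLineDerivAt.lineDeriv ?_
  unfold HasLineDerivAt pathLik
  simp only [perturb_add_smul]
  have h : ∀ t ∈ (Finset.univ : Finset (Fin m)), HasDerivAt
      (fun s : ℝ => perturb p θ (x t.castSucc) (x t.succ)
        + s * perturbDir p i j (x t.castSucc) (x t.succ))
      (perturbDir p i j (x t.castSucc) (x t.succ)) 0 := fun t _ => by
    simpa using ((hasDerivAt_id (0 : ℝ)).mul_const (perturbDir p i j (x t.castSucc)
      (x t.succ))).const_add (perturb p θ (x t.castSucc) (x t.succ))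
  refine ((HasDerivAt.fun_finsetProd h).const_mul (p (x 0))).congr_deriv ?_
  rw [mul_assoc, transSum]
  congr 1
  refine (Finset.sum_congr rfl fun t ht => ?_).trans (Finset.mul_sum _ _ _).symm
  rw [← Finset.mul_prod_erase _ _ ht]
  simp only [zero_mul, add_zero, smul_eq_mul]
  field_simp [hθ (x t.castSucc) (x t.succ)]

/-- Each of the first `m` samples is `i` with probability at most `u`; the last sample starts no
transition and is not counted. -/
theorem MarkovChain.expect_visits_le (P : MarkovChain k) {i : Fin k} {u : ℝ} (h0 : P.init i ≤ u)
    (h : ∀ a, P.trans a i ≤ u) (m : ℕ) :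
    P.expect (m + 1) (transSum fun a _ => if a = i then 1 else 0) ≤ m * u := by
  have hlast : ∀ m, P.expect (m + 1) (fun x => if x (Fin.last m) = i then 1 else 0) ≤ u := by
    intro m
    cases m with
    | zero =>
      rw [expect_one_sample]
      simpa using h0
    | succ m =>
      rw [expect_succ]
      refine (expect_mono (h := fun _ => u) fun x => ?_).trans (P.expect_const m _).le
      simpa using h _
  induction m with
  | zero => simp [transSum_one_sample, expect]
  | succ m ih =>
    rw [expect_succ]
    simp only [transSum_snoc, ← Finset.sum_mul, P.sum_trans, one_mul, expect_add]
    push_cast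
    linarith [hlast m]

/-- The Fisher information of a path about the entry `(i, j)`. -/
theorem MarkovChain.expect_score_sq_le (P : MarkovChain k) (hp : ∑ b, p b = 1) {ε : ℝ}
    (hε0 : 0 < ε) (hε1 : ε < 1) (hpos : ∀ b, 0 < p b) (hinit : P.init = p)
    (hclose : ∀ a b, |P.trans a b - p b| ≤ ε * p b) (i j : Fin k) (m : ℕ) :
    P.expect (m + 1) (fun x => transSum (fun a b => perturbDir p i j a b / P.trans a b) x ^ 2)
      ≤ m * ((1 + ε) / (1 - ε) * p i * ((1 - p j) / p j)) := by
  have hlow : ∀ a b, (1 - ε) * p b ≤ P.trans a b := fun a b => by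
    linarith [(abs_le.1 (hclose a b)).1]
  have hlow0 : ∀ b, 0 < (1 - ε) * p b := fun b => mul_pos (by linarith) (hpos b)
  have hMpos : ∀ a b, 0 < P.trans a b := fun a b => (hlow0 b).trans_le (hlow a b)
  rw [expect_transSum_sq]
  · have hcond : ∀ a, ∑ b, P.trans a b * (perturbDir p i j a b / P.trans a b) ^ 2
        ≤ (1 - p j) / p j / (1 - ε) * if a = i then 1 else 0 := by
      intro a
      by_cases ha : a = i
      · rw [if_pos ha, mul_one]
        have hb : ∀ b, P.trans a b * (perturbDir p i j a b / P.trans a b) ^ 2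
            ≤ (perturbDir p i j a b ^ 2 / p b) / (1 - ε) := by
          intro b
          rw [div_pow, div_div, mul_comm (p b), ← mul_div_assoc, mul_comm, sq (P.trans a b),
            mul_div_mul_right _ _ (hMpos a b).ne']
          exact div_le_div_of_nonneg_left (sq_nonneg _) (hlow0 b) (hlow a b)
        refine (Finset.sum_le_sum fun b _ => hb b).trans (le_of_eq ?_)
        rw [← Finset.sum_div]
        congr 1
        -- Summed over `b` this is `(1 - 2 p_j) / p_j + 1 = (1 - p_j) / p_j`.
        have : ∀ b, perturbDir p i j a b ^ 2 / p b
            = (if b = j then (1 - 2 * p j) / p j else 0) + p b := by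
          intro b
          have := (hpos b).ne'
          rw [perturbDir, if_pos ha]
          split_ifs with h
          · subst h
            field_simp
            ring
          · field_simp
            ring
        simp only [this, Finset.sum_add_distrib, hp]
        have := (hpos j).ne'
        simp
        field_simp
        ring
      · rw [if_neg ha, mul_zero]
        simp [perturbDir, ha]
    have hpj : p j ≤ 1 := by
      rw [← hp]
      exact Finset.single_le_sum (fun c _ => (hpos c).le) (Finset.mem_univ j)
    calc _ ≤ P.expect (m + 1) (fun x => (1 - p j) / p j / (1 - ε)
          * transSum (fun a _ => if a = i then 1 else 0) x) := by
          refine expect_mono fun x => ?_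
          rw [transSum, transSum, Finset.mul_sum]
          exact Finset.sum_le_sum fun t _ => hcond _
      _ ≤ (1 - p j) / p j / (1 - ε) * (m * ((1 + ε) * p i)) := by
          rw [expect_const_mul]
          refine mul_le_mul_of_nonneg_left (P.expect_visits_le ?_ (fun a => ?_) m) ?_
          · rw [hinit]
            nlinarith [hpos i]
          · linarith [(abs_le.1 (hclose a i)).2]
          · exact div_nonneg (div_nonneg (by linarith) (hpos j).le) (by linarith)
      _ = _ := by ring
  · intro a
    rw [← sum_perturbDir hp i j a]
    exact Finset.sum_congr rfl fun b _ => mul_div_cancel₀ _ (hMpos a b).ne'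

end perturb

/-! ### The van Trees inequality for one entry, and its minimax form -/

section vanTrees

variable {k : ℕ} {p : Fin k → ℝ}

theorem exists_chain_perturb (hp : p ∈ stdSimplex ℝ (Fin k)) {θ : Fin k → Fin k → ℝ}
    (hθ : ∀ a b, 0 ≤ perturb p θ a b) :
    ∃ P : MarkovChain k, P.init = p ∧ P.trans = perturb p θ ∧
      ∀ m, ∀ x : Fin (m + 1) → Fin k, P.prob (m + 1) x = pathLik p x θ :=
  ⟨⟨p, perturb p θ, hp, (Matrix.mem_rowStochastic_iff_sum).2 ⟨hθ, sum_perturb hp.2 θ⟩⟩, rfl, rfl,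
    fun _ _ => rfl⟩

/-- The mean square error of an estimator of the entry `(i, j)` of `perturb p θ`. -/
def sqError (p : Fin k → ℝ) (i j : Fin k) {m : ℕ} (T : (Fin (m + 1) → Fin k) → ℝ)
    (θ : Fin k → Fin k → ℝ) : ℝ :=
  ∑ x, pathLik p x θ * (perturb p θ i j - T x) ^ 2

theorem continuous_sqError (i j : Fin k) {m : ℕ} (T : (Fin (m + 1) → Fin k) → ℝ) :
    Continuous (sqError p i j T) :=
  continuous_finsetSum _ fun x _ => (contDiff_pathLik x).continuous.mul
    (((contDiff_perturb i j).continuous.sub continuous_const).pow 2)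

/-- The error of an estimator, weighted by the likelihood and the prior density. -/
def weightedError (p : Fin k → ℝ) (ρ : (Fin k → Fin k → ℝ) → ℝ) (i j : Fin k) {m : ℕ}
    (T : (Fin (m + 1) → Fin k) → ℝ) (x : Fin (m + 1) → Fin k) (θ : Fin k → Fin k → ℝ) : ℝ :=
  (T x - perturb p θ i j) * pathLik p x θ * ρ θ ^ 2

theorem contDiff_weightedError {ρ : (Fin k → Fin k → ℝ) → ℝ} (hρ : ContDiff ℝ 1 ρ) (i j : Fin k)
    {m : ℕ} (T : (Fin (m + 1) → Fin k) → ℝ) (x : Fin (m + 1) → Fin k) :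
    ContDiff ℝ 1 (weightedError p ρ i j T x) :=
  ((contDiff_const.sub (contDiff_perturb i j)).mul (contDiff_pathLik x)).mul (hρ.pow 2)

theorem fderiv_weightedError {ρ : (Fin k → Fin k → ℝ) → ℝ} (hρ : ContDiff ℝ 1 ρ) (i j : Fin k)
    {m : ℕ} (T : (Fin (m + 1) → Fin k) → ℝ) (x : Fin (m + 1) → Fin k) (θ : Fin k → Fin k → ℝ) :
    fderiv ℝ (weightedError p ρ i j T x) θ (coordDir i j)
      = ((T x - perturb p θ i j) * fderiv ℝ (pathLik p x) θ (coordDir i j)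
          - (1 - p j) * pathLik p x θ) * ρ θ ^ 2
        + (T x - perturb p θ i j) * pathLik p x θ
            * (2 * ρ θ * fderiv ℝ ρ θ (coordDir i j)) := by
  have h1 := ((contDiff_perturb (p := p) i j).differentiable one_ne_zero θ).hasFDerivAt
  have h2 := ((contDiff_pathLik (p := p) x).differentiable one_ne_zero θ).hasFDerivAt
  have h3 := (hρ.differentiable one_ne_zero θ).hasFDerivAt
  have h := ((h1.const_sub (T x)).mul h2).mul (h3.pow 2)
  have := congrArg (fun l => l (coordDir i j)) h.fderiv
  refine Eq.trans this ?_
  simp only [add_apply, smul_apply,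
    neg_apply, smul_eq_mul, fderiv_perturb]
  simp [perturbDir]
  ring

/-- The integrand of the van Trees inequality. With `s` the score, the left side is the expectation
of `(T - M_ij) ρ * (s ρ + 2 ∂ρ)`. Young's inequality with a free `c` replaces Cauchy-Schwarz and can
be integrated in `θ` directly; the cross term of `s` and `∂ρ` vanishes since the score has mean
zero. -/
theorem sum_fderiv_weightedError_le (hp : p ∈ stdSimplex ℝ (Fin k)) (hpos : ∀ b, 0 < p b) {ε : ℝ}
    (hε0 : 0 < ε) (hε1 : ε < 1) {ρ : (Fin k → Fin k → ℝ) → ℝ} (hρ : ContDiff ℝ 1 ρ)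
    (hsupp : ∀ θ, ρ θ ≠ 0 → ∀ a b, |perturb p θ a b - p b| ≤ ε * p b) (i j : Fin k)
    {m : ℕ} (T : (Fin (m + 1) → Fin k) → ℝ) {c : ℝ} (hc : 0 < c) (θ : Fin k → Fin k → ℝ) :
    ∑ x, fderiv ℝ (weightedError p ρ i j T x) θ (coordDir i j) + (1 - p j) * ρ θ ^ 2
      ≤ c / 2 * (ρ θ ^ 2 * sqError p i j T θ)
        + (2 * c)⁻¹ * (m * ((1 + ε) / (1 - ε) * p i * ((1 - p j) / p j)) * ρ θ ^ 2
            + 4 * fderiv ℝ ρ θ (coordDir i j) ^ 2) := by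
  simp only [fderiv_weightedError hρ]
  by_cases h0 : ρ θ = 0
  · simp only [h0]
    simp
    positivity
  have hclose := hsupp θ h0
  have hθpos : ∀ a b, 0 < perturb p θ a b := fun a b => by
    nlinarith [(abs_le.1 (hclose a b)).1, hpos b]
  obtain ⟨P, hinit, htrans, hprob⟩ := exists_chain_perturb hp fun a b => (hθpos a b).le
  simp only [fderiv_pathLik i j _ θ fun a b => (hθpos a b).ne', sqError, ← hprob]
  rw [← htrans] at hclose hθpos ⊢
  have hinfo := P.expect_score_sq_le hp.2 hε0 hε1 hpos hinit hclose i j m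
  set s := fun x : Fin (m + 1) → Fin k =>
    transSum (fun a b => perturbDir p i j a b / P.trans a b) x with hs
  have hmean : P.expect (m + 1) s = 0 := by
    rw [hs, P.expect_transSum]
    have : ∀ a, ∑ b, P.trans a b * (perturbDir p i j a b / P.trans a b) = 0 := fun a => by
      rw [← sum_perturbDir hp.2 i j a]
      exact Finset.sum_congr rfl fun b _ => mul_div_cancel₀ _ (hθpos a b).ne'
    simp [this, transSum, MarkovChain.expect]
  set d := fderiv ℝ ρ θ (coordDir i j)
  set r := ρ θ
  have hsum1 := P.expect_one m
  have hcs : ∀ x, (T x - P.trans i j) * r * (s x * r + 2 * d)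
      ≤ c / 2 * r ^ 2 * (P.trans i j - T x) ^ 2 + ((2 * c)⁻¹ * r ^ 2 * s x ^ 2
        + ((2 * c)⁻¹ * (4 * r * d) * s x + (2 * c)⁻¹ * (4 * d ^ 2))) := by
    intro x
    have : 0 ≤ (2 * c)⁻¹ * (c * ((T x - P.trans i j) * r) - (s x * r + 2 * d)) ^ 2 := by positivity
    have e : (2 * c)⁻¹ * (c * ((T x - P.trans i j) * r) - (s x * r + 2 * d)) ^ 2
      = c / 2 * r ^ 2 * (P.trans i j - T x) ^ 2 + ((2 * c)⁻¹ * r ^ 2 * s x ^ 2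
        + ((2 * c)⁻¹ * (4 * r * d) * s x + (2 * c)⁻¹ * (4 * d ^ 2)))
        - (T x - P.trans i j) * r * (s x * r + 2 * d) := by
      field_simp
      ring
    linarith
  have hE := P.expect_mono hcs
  simp only [P.expect_add, P.expect_const_mul, hmean, P.expect_const] at hE
  calc _ = P.expect (m + 1) (fun x => (T x - P.trans i j) * r * (s x * r + 2 * d)) := by
        have : (1 - p j) * r ^ 2 = (1 - p j) * r ^ 2 * P.expect (m + 1) fun _ => 1 := by
          rw [hsum1, mul_one]
        rw [this]
        simp only [MarkovChain.expect, Finset.mul_sum, ← Finset.sum_add_distrib]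
        refine Finset.sum_congr rfl fun x _ => ?_
        ring
    _ ≤ _ := hE
    _ ≤ _ := by
        have h := mul_le_mul_of_nonneg_left hinfo (show 0 ≤ (2 * c)⁻¹ * r ^ 2 by positivity)
        unfold MarkovChain.expect at h ⊢
        nlinarith

theorem HasCompactSupport.sq_real {E : Type*} [TopologicalSpace E] {g : E → ℝ}
    (hg : HasCompactSupport g) : HasCompactSupport fun θ => g θ ^ 2 :=
  hg.comp_left (g := fun y : ℝ => y ^ 2) (by simp)

theorem integrable_sq_density {ρ : (Fin k → Fin k → ℝ) → ℝ} (hρ : Continuous ρ)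
    (hcs : HasCompactSupport ρ) : Integrable fun θ => ρ θ ^ 2 := by
  have h := hcs.sq_real
  exact (hρ.pow 2).integrable_of_hasCompactSupport h

theorem integrable_sq_mul_sqError {ρ : (Fin k → Fin k → ℝ) → ℝ} (hρ : Continuous ρ)
    (hcs : HasCompactSupport ρ) (i j : Fin k) {m : ℕ} (T : (Fin (m + 1) → Fin k) → ℝ) :
    Integrable fun θ => ρ θ ^ 2 * sqError p i j T θ := by
  have h : HasCompactSupport fun θ => ρ θ ^ 2 * sqError p i j T θ := hcs.sq_real.mul_right
  exact ((hρ.pow 2).mul (continuous_sqError i j T)).integrable_of_hasCompactSupport h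

theorem integrable_sq_fderiv {ρ : (Fin k → Fin k → ℝ) → ℝ} (hρ : ContDiff ℝ 1 ρ)
    (hcs : HasCompactSupport ρ) (v : Fin k → Fin k → ℝ) :
    Integrable fun θ => fderiv ℝ ρ θ v ^ 2 := by
  have h := (hcs.fderiv_apply (𝕜 := ℝ) v).sq_real
  have hc : Continuous fun θ => fderiv ℝ ρ θ v :=
    (hρ.continuous_fderiv one_ne_zero).clm_apply continuous_const
  exact (hc.pow 2).integrable_of_hasCompactSupport h

theorem hasCompactSupport_weightedError {ρ : (Fin k → Fin k → ℝ) → ℝ}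
    (hcs : HasCompactSupport ρ) (i j : Fin k) {m : ℕ} (T : (Fin (m + 1) → Fin k) → ℝ)
    (x : Fin (m + 1) → Fin k) : HasCompactSupport (weightedError p ρ i j T x) :=
  hcs.sq_real.mul_left

theorem integrable_fderiv_weightedError {ρ : (Fin k → Fin k → ℝ) → ℝ} (hρ : ContDiff ℝ 1 ρ)
    (hcs : HasCompactSupport ρ) (i j : Fin k) {m : ℕ} (T : (Fin (m + 1) → Fin k) → ℝ)
    (x : Fin (m + 1) → Fin k) (v : Fin k → Fin k → ℝ) :
    Integrable fun θ => fderiv ℝ (weightedError p ρ i j T x) θ v :=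
  (((contDiff_weightedError hρ i j T x).continuous_fderiv one_ne_zero).clm_apply
    continuous_const).integrable_of_hasCompactSupport
      ((hasCompactSupport_weightedError hcs i j T x).fderiv_apply (𝕜 := ℝ) v)

/-- On integrating the pointwise bound, the derivative terms drop out by compact support. -/
theorem one_sub_le_bayes_sqError (hp : p ∈ stdSimplex ℝ (Fin k)) (hpos : ∀ b, 0 < p b) {ε : ℝ}
    (hε0 : 0 < ε) (hε1 : ε < 1) {ρ : (Fin k → Fin k → ℝ) → ℝ} (hρ : ContDiff ℝ 1 ρ)
    (hcs : HasCompactSupport ρ) (hint : ∫ θ, ρ θ ^ 2 = 1)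
    (hsupp : ∀ θ, ρ θ ≠ 0 → ∀ a b, |perturb p θ a b - p b| ≤ ε * p b) (i j : Fin k)
    {m : ℕ} (T : (Fin (m + 1) → Fin k) → ℝ) {c : ℝ} (hc : 0 < c) :
    1 - p j ≤ c / 2 * (∫ θ, ρ θ ^ 2 * sqError p i j T θ)
      + (2 * c)⁻¹ * (m * ((1 + ε) / (1 - ε) * p i * ((1 - p j) / p j))
        + 4 * ∫ θ, fderiv ℝ ρ θ (coordDir i j) ^ 2) := by
  generalize hJ : m * ((1 + ε) / (1 - ε) * p i * ((1 - p j) / p j)) = J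
  have i1 := integrable_sq_density hρ.continuous hcs
  have i2 := integrable_sq_mul_sqError (p := p) hρ.continuous hcs i j T
  have i3 := integrable_sq_fderiv hρ hcs (coordDir i j)
  have i4 := fun x => integrable_fderiv_weightedError (p := p) hρ hcs i j T x (coordDir i j)
  have i5 : Integrable fun θ => ∑ x, fderiv ℝ (weightedError p ρ i j T x) θ (coordDir i j) :=
    integrable_finsetSum _ fun x _ => i4 x
  have i6 : Integrable fun θ => (2 * c)⁻¹ * (J * ρ θ ^ 2 + 4 * fderiv ℝ ρ θ (coordDir i j) ^ 2) :=
    ((i1.const_mul J).add (i3.const_mul 4)).const_mul (2 * c)⁻¹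
  have hmono : ∫ θ, (∑ x, fderiv ℝ (weightedError p ρ i j T x) θ (coordDir i j)
        + (1 - p j) * ρ θ ^ 2)
      ≤ ∫ θ, (c / 2 * (ρ θ ^ 2 * sqError p i j T θ)
        + (2 * c)⁻¹ * (J * ρ θ ^ 2 + 4 * fderiv ℝ ρ θ (coordDir i j) ^ 2)) := by
    refine integral_mono (i5.add (i1.const_mul (1 - p j))) ((i2.const_mul (c / 2)).add i6)
      fun θ => ?_
    rw [← hJ]
    exact sum_fderiv_weightedError_le hp hpos hε0 hε1 hρ hsupp i j T hc θ
  rw [integral_add i5 (i1.const_mul _), integral_add (i2.const_mul _) i6,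
    integral_finsetSum _ (fun x _ => i4 x), integral_const_mul, integral_const_mul,
    integral_const_mul, integral_add (i1.const_mul J) (i3.const_mul 4), integral_const_mul,
    integral_const_mul, hint, Finset.sum_eq_zero fun x _ => integral_fderiv_apply_eq_zero _
      (contDiff_weightedError hρ i j T x) (hasCompactSupport_weightedError hcs i j T x) _,
    zero_add, mul_one, mul_one] at hmono
  exact hmono

theorem bayes_sqError_ge (hp : p ∈ stdSimplex ℝ (Fin k)) (hpos : ∀ b, 0 < p b) {ε : ℝ}
    (hε0 : 0 < ε) (hε1 : ε < 1) {ρ : (Fin k → Fin k → ℝ) → ℝ} (hρ : ContDiff ℝ 1 ρ)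
    (hcs : HasCompactSupport ρ) (hint : ∫ θ, ρ θ ^ 2 = 1)
    (hsupp : ∀ θ, ρ θ ≠ 0 → ∀ a b, |perturb p θ a b - p b| ≤ ε * p b) (i j : Fin k) (hj : p j < 1)
    {m : ℕ} (hm : 0 < m) (T : (Fin (m + 1) → Fin k) → ℝ) :
    (1 - p j) ^ 2 / (m * ((1 + ε) / (1 - ε) * p i * ((1 - p j) / p j))
        + 4 * ∫ θ, fderiv ℝ ρ θ (coordDir i j) ^ 2)
      ≤ ∫ θ, ρ θ ^ 2 * sqError p i j T θ := by
  have h := fun c (hc : 0 < c) => one_sub_le_bayes_sqError hp hpos hε0 hε1 hρ hcs hint hsupp i j T hc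
  have ha : 0 < 1 - p j := by linarith
  have hD : 0 < m * ((1 + ε) / (1 - ε) * p i * ((1 - p j) / p j))
      + 4 * ∫ θ, fderiv ℝ ρ θ (coordDir i j) ^ 2 := by
    have := hpos i
    have := hpos j
    have : 0 < 1 - ε := by linarith
    have : (0 : ℝ) < m := by exact_mod_cast hm
    exact add_pos_of_pos_of_nonneg (by positivity)
      (mul_nonneg (by norm_num) (integral_nonneg fun θ => sq_nonneg _))
  generalize m * ((1 + ε) / (1 - ε) * p i * ((1 - p j) / p j))
      + 4 * ∫ θ, fderiv ℝ ρ θ (coordDir i j) ^ 2 = D at h hD ⊢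
  -- This `c` balances the two terms of the bound in the case of equality.
  have hc := h (D / (1 - p j)) (by positivity)
  rw [div_le_iff₀ hD]
  generalize ∫ θ, ρ θ ^ 2 * sqError p i j T θ = R at hc ⊢
  have e : (2 * (D / (1 - p j)))⁻¹ * D = (1 - p j) / 2 := by field_simp
  have e2 : D / (1 - p j) / 2 * R * (1 - p j) = R * D / 2 := by field_simp
  rw [e] at hc
  nlinarith

/-- A local minimax lower bound for weighted sums of mean square errors of the entries. -/
theorem exists_minimax_sqError_ge (hp : p ∈ stdSimplex ℝ (Fin k)) (hpos : ∀ b, 0 < p b)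
    (hlt : ∀ b, p b < 1) {ε : ℝ} (hε0 : 0 < ε) (hε1 : ε < 1) :
    ∃ K : ℝ, 0 ≤ K ∧ ∀ m : ℕ, 0 < m → ∀ (T : (Fin (m + 1) → Fin k) → Fin k → Fin k → ℝ)
      (w : Fin k → Fin k → ℝ), (∀ i j, 0 ≤ w i j) → ∀ S : ℝ,
      (∀ P : MarkovChain k, (∀ a b, |P.trans a b - p b| ≤ ε * p b) →
        ∑ i, ∑ j, w i j * P.expect (m + 1) (fun x => (P.trans i j - T x i j) ^ 2) ≤ S) →
      ∑ i, ∑ j, w i j * ((1 - p j) ^ 2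
        / (m * ((1 + ε) / (1 - ε) * p i * ((1 - p j) / p j)) + K)) ≤ S := by
  -- `abs_perturb_sub_le` turns this radius into closeness to `p` on the whole support of the prior.
  obtain ⟨r, hr0, hr⟩ : ∃ r : ℝ, 0 < r ∧ ∀ b, (k + 1) * r ≤ ε * p b := by
    have hev : ∀ᶠ r in 𝓝[>] (0 : ℝ), ∀ b, (k + 1) * r < ε * p b := by
      refine eventually_all.2 fun b => ?_
      have : Tendsto (fun r : ℝ => (k + 1) * r) (𝓝[>] 0) (𝓝 ((k + 1) * 0)) :=
        (continuous_const.mul continuous_id).continuousWithinAt.tendsto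
      rw [mul_zero] at this
      exact this.eventually_lt_const (mul_pos hε0 (hpos b))
    obtain ⟨r, hr1, hr2⟩ := (hev.and self_mem_nhdsWithin).exists
    exact ⟨r, hr2, fun b => (hr1 b).le⟩
  obtain ⟨ρ, hρ, hcs, hsm, hint⟩ :=
    exists_smooth_sqrt_density (Fin k → Fin k → ℝ) volume hr0
  have hsupp : ∀ θ, ρ θ ≠ 0 → ∀ a b, |perturb p θ a b - p b| ≤ ε * p b := fun θ h a b =>
    (abs_perturb_sub_le hp (hsm θ h).le a b).trans (hr b)
  set κ := fun i j : Fin k => 4 * ∫ θ, fderiv ℝ ρ θ (coordDir i j) ^ 2 with hκ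
  have hκ0 : ∀ i j, 0 ≤ κ i j := fun i j =>
    mul_nonneg (by norm_num) (integral_nonneg fun θ => sq_nonneg _)
  -- One constant above the prior information of every entry; it does not depend on `m`, so it is
  -- negligible beside the information of the path.
  refine ⟨∑ i, ∑ j, κ i j, Finset.sum_nonneg fun i _ => Finset.sum_nonneg fun j _ => hκ0 i j, ?_⟩
  intro m hm T w hw S hS
  have i1 := integrable_sq_density hρ.continuous hcs
  have i2 := fun i j =>
    integrable_sq_mul_sqError (p := p) hρ.continuous hcs i j fun x => T x i j
  have i3 : ∀ i j, Integrable
      (fun θ => w i j * (ρ θ ^ 2 * sqError p i j (fun x => T x i j) θ)) := fun i j =>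
    (i2 i j).const_mul _
  calc _ ≤ ∑ i, ∑ j, w i j * ∫ θ, ρ θ ^ 2 * sqError p i j (fun x => T x i j) θ := by
        refine Finset.sum_le_sum fun i _ => Finset.sum_le_sum fun j _ =>
          mul_le_mul_of_nonneg_left (le_trans ?_
            (bayes_sqError_ge hp hpos hε0 hε1 hρ hcs hint hsupp i j (hlt j) hm _)) (hw i j)
        have h1 : 0 < 1 - p j := by linarith [hlt j]
        have h2 : 0 < 1 - ε := by linarith
        have h3 := hpos i
        have h4 := hpos j
        have h5 : (0 : ℝ) < m := by exact_mod_cast hm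
        refine div_le_div_of_nonneg_left (sq_nonneg _) (add_pos_of_pos_of_nonneg (by positivity)
          (hκ0 i j)) (add_le_add_right ?_ _)
        exact (Finset.single_le_sum (f := κ i) (fun j _ => hκ0 i j) (Finset.mem_univ j)).trans
          (Finset.single_le_sum (f := fun i => ∑ j, κ i j)
            (fun i _ => Finset.sum_nonneg fun j _ => hκ0 i j) (Finset.mem_univ i))
    _ = ∫ θ, ∑ i, ∑ j, w i j * (ρ θ ^ 2 * sqError p i j (fun x => T x i j) θ) := by
        rw [integral_finsetSum _ fun i _ => integrable_finsetSum _ fun j _ => i3 i j]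
        refine Finset.sum_congr rfl fun i _ => ?_
        rw [integral_finsetSum _ fun j _ => i3 i j]
        exact Finset.sum_congr rfl fun j _ => (integral_const_mul _ _).symm
    _ ≤ ∫ θ, S * ρ θ ^ 2 := by
        refine integral_mono (integrable_finsetSum _ fun i _ => integrable_finsetSum _
          fun j _ => i3 i j) (i1.const_mul S) fun θ => ?_
        have e : ∑ i, ∑ j, w i j * (ρ θ ^ 2 * sqError p i j (fun x => T x i j) θ)
            = (∑ i, ∑ j, w i j * sqError p i j (fun x => T x i j) θ) * ρ θ ^ 2 := by
          simp only [Finset.sum_mul]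
          exact Finset.sum_congr rfl fun i _ => Finset.sum_congr rfl fun j _ => by ring
        simp only [e]
        by_cases h0 : ρ θ = 0
        · simp [h0]
        have hclose := hsupp θ h0
        obtain ⟨P, hinit, htrans, hprob⟩ := exists_chain_perturb hp (θ := θ) fun a b => by
          nlinarith [(abs_le.1 (hclose a b)).1, hpos b]
        refine mul_le_mul_of_nonneg_right ?_ (sq_nonneg _)
        rw [← htrans] at hclose
        refine le_trans (le_of_eq ?_) (hS P hclose)
        simp only [sqError, MarkovChain.expect, hprob, htrans]
    _ = S := by rw [integral_const_mul, hint, mul_one]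

end vanTrees

/-! ### Extended-real risks and the minimax lower bounds -/

theorem EReal.coe_sum_real {ι : Type*} (s : Finset ι) (g : ι → ℝ) :
    ((∑ i ∈ s, g i : ℝ) : EReal) = ∑ i ∈ s, (g i : EReal) := by
  classical
  induction s using Finset.induction_on with
  | empty => simp
  | insert a s ha ih => rw [Finset.sum_insert ha, Finset.sum_insert ha, EReal.coe_add, ih]

section risk

variable {k n : ℕ} {L : (Fin k → ℝ) → (Fin k → ℝ) → EReal} {P : MarkovChain k}
  {Mhat : Estimator k n} {i : Fin k}

theorem coe_expect_le_stateRisk {g : (Fin n → Fin k) → ℝ}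
    (h : ∀ x, (g x : EReal) ≤ L (P.trans i) ((Mhat x).1 i)) :
    ((P.expect n g : ℝ) : EReal) ≤ stateRisk L P Mhat i := by
  rw [MarkovChain.expect, EReal.coe_sum_real]
  refine Finset.sum_le_sum fun x _ => ?_
  rw [EReal.coe_mul]
  exact mul_le_mul_of_nonneg_left (h x) (EReal.coe_nonneg.2 (P.prob_nonneg n x))

theorem stateRisk_le_coe_expect {g : (Fin n → Fin k) → ℝ}
    (h : ∀ x, L (P.trans i) ((Mhat x).1 i) ≤ (g x : EReal)) :
    stateRisk L P Mhat i ≤ ((P.expect n g : ℝ) : EReal) := by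
  rw [MarkovChain.expect, EReal.coe_sum_real]
  refine Finset.sum_le_sum fun x _ => ?_
  rw [EReal.coe_mul]
  exact mul_le_mul_of_nonneg_left (h x) (EReal.coe_nonneg.2 (P.prob_nonneg n x))

theorem MarkovChain.stationary_nonneg (P : MarkovChain k) (i : Fin k) : 0 ≤ P.stationary i :=
  P.isStationaryDist_stationary.1.1 i

theorem MarkovChain.sum_stationary (P : MarkovChain k) : ∑ i, P.stationary i = 1 :=
  P.isStationaryDist_stationary.1.2

theorem MarkovChain.sum_stationary_mul (P : MarkovChain k) (j : Fin k) :
    ∑ i, P.stationary i * P.trans i j = P.stationary j :=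
  congrFun P.isStationaryDist_stationary.2 j

theorem MarkovChain.le_stationary (P : MarkovChain k) {c : ℝ} {j : Fin k}
    (h : ∀ i, c ≤ P.trans i j) : c ≤ P.stationary j := by
  rw [← P.sum_stationary_mul j]
  calc c = ∑ i, P.stationary i * c := by rw [← Finset.sum_mul, P.sum_stationary, one_mul]
    _ ≤ _ := Finset.sum_le_sum fun i _ => mul_le_mul_of_nonneg_left (h i) (P.stationary_nonneg i)

theorem coe_sum_le_weightedRisk {r : Fin k → ℝ} (h : ∀ i, (r i : EReal) ≤ stateRisk L P Mhat i) :
    ((∑ i, P.stationary i * r i : ℝ) : EReal) ≤ weightedRisk L P Mhat := by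
  rw [EReal.coe_sum_real]
  refine Finset.sum_le_sum fun i _ => ?_
  rw [EReal.coe_mul]
  exact mul_le_mul_of_nonneg_left (h i) (EReal.coe_nonneg.2 (P.stationary_nonneg i))

theorem weightedRisk_le_coe_sum {r : Fin k → ℝ} (h : ∀ i, stateRisk L P Mhat i ≤ (r i : EReal)) :
    weightedRisk L P Mhat ≤ ((∑ i, P.stationary i * r i : ℝ) : EReal) := by
  rw [EReal.coe_sum_real]
  refine Finset.sum_le_sum fun i _ => ?_
  rw [EReal.coe_mul]
  exact mul_le_mul_of_nonneg_left (h i) (EReal.coe_nonneg.2 (P.stationary_nonneg i))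

theorem fDiv_ge_of_terms {f : ℝ → ℝ} {p q : Fin k → ℝ} (hp : ∑ j, p j = 1) (hq : ∑ j, q j = 1)
    {c : ℝ} {g : Fin k → ℝ} (h : ∀ j, ((c * (p j - q j) + g j : ℝ) : EReal) ≤ fDivTerm f (p j) (q j)) :
    ((∑ j, g j : ℝ) : EReal) ≤ fDiv f p q := by
  have e : ∑ j, g j = ∑ j, (c * (p j - q j) + g j) := by
    rw [Finset.sum_add_distrib, ← Finset.mul_sum, Finset.sum_sub_distrib, hp, hq]
    ring
  rw [e, EReal.coe_sum_real]
  exact Finset.sum_le_sum fun j _ => h j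

theorem tendsto_mul_div_linear {a Γ K : ℝ} (hΓ : 0 < Γ) :
    Tendsto (fun m : ℕ => (m : ℝ) * (a / (m * Γ + K))) atTop (𝓝 (a / Γ)) := by
  have h : Tendsto (fun m : ℕ => a / (Γ + K / m)) atTop (𝓝 (a / (Γ + 0))) :=
    tendsto_const_nhds.div (tendsto_const_nhds.add (tendsto_const_div_atTop_nhds_zero_nat K))
      (by rw [add_zero]; exact hΓ.ne')
  rw [add_zero] at h
  refine h.congr' ?_
  filter_upwards [eventually_gt_atTop 0] with m hm
  have hm' : (m : ℝ) ≠ 0 := by exact_mod_cast hm.ne'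
  have : (m : ℝ) * Γ + K = m * (Γ + K / m) := by field_simp
  rw [this, mul_div_assoc', mul_div_mul_left _ _ hm']

/-- One statement for both risks: near `p` the risk need only dominate `∑ u_i r_i`. The radius `η`
precedes `u` because the weighted risk uses weights depending on `η`. -/
theorem eventually_minimax_ge {f : ℝ → ℝ} (hf : IsOrdinary f) {p : Fin k → ℝ} {δ : ℝ}
    (hp : p ∈ stdSimplex ℝ (Fin k)) (hpδ : ∀ b, δ < p b) (hδ : 0 ≤ δ) (hk : 2 ≤ k)
    {τ : ℝ} (hτ0 : 0 < τ) (hτ1 : τ < 1) :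
    ∃ η, 0 < η ∧ η ≤ τ ∧ ∀ u : Fin k → ℝ, (∀ i, 0 ≤ u i) → 0 < ∑ i, u i / p i →
      ∀ᶠ m : ℕ in atTop, ∀ risk : MarkovChain k → Estimator k (m + 1) → EReal,
        (∀ P Mhat, (∀ a b, |P.trans a b - p b| ≤ η * p b) → ∀ r : Fin k → ℝ, (∀ i, 0 ≤ r i) →
          (∀ i, (r i : EReal) ≤ stateRisk (fDiv f) P Mhat i) →
          ((∑ i, u i * r i : ℝ) : EReal) ≤ risk P Mhat) →
        (((1 - τ) * ((∑ i, u i / p i) * ((k - 1) * deriv (deriv f) 1 / 2)) / (m + 1 : ℕ) : ℝ) : EReal)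
          ≤ minimax risk (chainsAtLeast k δ) := by
  have hpos : ∀ b, 0 < p b := fun b => hδ.trans_lt (hpδ b)
  have hlt : ∀ b, p b < 1 := by
    intro b
    have : Nontrivial (Fin k) := Fin.nontrivial_iff_two_le.2 hk
    obtain ⟨c, hc⟩ := exists_ne b
    rw [← hp.2]
    exact Finset.single_lt_sum hc (Finset.mem_univ _) (Finset.mem_univ c) (hpos c)
      fun d _ _ => (hpos d).le
  have hF := hf.deriv_two_pos
  set F := deriv (deriv f) 1 with hFdef
  set ε := τ / 4 with hε
  have hε0 : 0 < ε := by positivity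
  obtain ⟨η₀, hη₀, hη₁, hterm⟩ := hf.exists_fDivTerm_ge_sq hε0 (by linarith)
  obtain ⟨η, hη0, hηε, hηη, hηδ⟩ : ∃ η, 0 < η ∧ η ≤ ε ∧ η ≤ η₀ ∧ ∀ b, δ ≤ (1 - η) * p b := by
    have hev : ∀ᶠ η in 𝓝[>] (0 : ℝ), ∀ b, δ < (1 - η) * p b := by
      refine eventually_all.2 fun b => ?_
      have : Tendsto (fun η : ℝ => (1 - η) * p b) (𝓝[>] 0) (𝓝 ((1 - 0) * p b)) := by
        refine Continuous.continuousWithinAt (by fun_prop)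
      rw [sub_zero, one_mul] at this
      exact this.eventually_const_lt (hpδ b)
    obtain ⟨η, h1, h2⟩ := (hev.and (Ioo_mem_nhdsGT (lt_min hε0 hη₀))).exists
    exact ⟨η, h2.1, h2.2.le.trans (min_le_left _ _), h2.2.le.trans (min_le_right _ _),
      fun b => (h1 b).le⟩
  refine ⟨η, hη0, by linarith, fun u hu hupos => ?_⟩
  have hη1 : η < 1 := by linarith
  obtain ⟨K, hK, hmain⟩ := exists_minimax_sqError_ge hp hpos hlt hη0 hη1
  set w := fun i j : Fin k => u i * ((1 - ε) * (F / (2 * p j))) with hw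
  have hw0 : ∀ i j, 0 ≤ w i j := fun i j => by
    have : 0 ≤ 1 - ε := by linarith
    have := hpos j
    have := hu i
    positivity
  have hΓ : ∀ i j, 0 < (1 + η) / (1 - η) * p i * ((1 - p j) / p j) := fun i j => by
    have : 0 < 1 - η := by linarith
    have := hpos i
    have := hpos j
    have : 0 < 1 - p j := by linarith [hlt j]
    positivity
  have hlim : Tendsto (fun m : ℕ => (m : ℝ) * ∑ i, ∑ j, w i j * ((1 - p j) ^ 2
        / (m * ((1 + η) / (1 - η) * p i * ((1 - p j) / p j)) + K))) atTop
      (𝓝 (∑ i, ∑ j, w i j * ((1 - p j) ^ 2 / ((1 + η) / (1 - η) * p i * ((1 - p j) / p j))))) := by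
    have : ∀ m : ℕ, (m : ℝ) * ∑ i, ∑ j, w i j * ((1 - p j) ^ 2
        / (m * ((1 + η) / (1 - η) * p i * ((1 - p j) / p j)) + K))
        = ∑ i, ∑ j, w i j * (m * ((1 - p j) ^ 2
        / (m * ((1 + η) / (1 - η) * p i * ((1 - p j) / p j)) + K))) := fun m => by
      simp only [Finset.mul_sum]
      exact Finset.sum_congr rfl fun i _ => Finset.sum_congr rfl fun j _ => by ring
    simp only [this]
    exact tendsto_finsetSum _ fun i _ => tendsto_finsetSum _ fun j _ =>
      (tendsto_mul_div_linear (hΓ i j)).const_mul _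
  have hval : ∑ i, ∑ j, w i j * ((1 - p j) ^ 2 / ((1 + η) / (1 - η) * p i * ((1 - p j) / p j)))
      = (1 - ε) * ((1 - η) / (1 + η)) * ((∑ i, u i / p i) * ((k - 1) * F / 2)) := by
    have h1 : ∀ i j, w i j * ((1 - p j) ^ 2 / ((1 + η) / (1 - η) * p i * ((1 - p j) / p j)))
        = (1 - ε) * ((1 - η) / (1 + η)) * (F / 2) * (u i / p i) * (1 - p j) := by
      intro i j
      have h2 : (1 - η) ≠ 0 := by linarith
      have h3 : (1 + η) ≠ 0 := by linarith
      have h4 := (hpos i).ne'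
      have h5 := (hpos j).ne'
      have h6 : 1 - p j ≠ 0 := by linarith [hlt j]
      simp only [hw]
      field_simp
    have h2 : ∑ j, (1 - p j) = (k : ℝ) - 1 := by simp [hp.2]
    simp only [h1, ← Finset.mul_sum, h2, ← Finset.sum_mul]
    ring
  rw [hval] at hlim
  set C := (∑ i, u i / p i) * ((k - 1) * F / 2) with hC
  have hk1 : (0 : ℝ) < k - 1 := by
    have : (2 : ℝ) ≤ k := by exact_mod_cast hk
    linarith
  have hC0 : 0 < C := by positivity
  -- `η ≤ ε` gives `(1 - η) / (1 + η) ≥ 1 - 2 ε`, and `(1 - ε) (1 - 2 ε) > 1 - 4 ε = 1 - τ`.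
  have hlt' : (1 - τ) * C < (1 - ε) * ((1 - η) / (1 + η)) * C := by
    refine mul_lt_mul_of_pos_right ?_ hC0
    have : 1 - 2 * ε ≤ (1 - η) / (1 + η) := by
      rw [le_div_iff₀ (by linarith)]
      nlinarith
    nlinarith
  filter_upwards [hlim.eventually_const_lt hlt', eventually_gt_atTop 0] with m hm hm0 risk hrisk
  have hm0' : (0 : ℝ) < m := by exact_mod_cast hm0
  refine le_iInf fun Mhat => ?_
  -- The risk may be infinite, so a failing estimator is first given a finite bound `S`.
  by_contra! hcon
  obtain ⟨S, hS1, hS2⟩ := EReal.lt_iff_exists_real_btwn.1 hcon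
  -- `hmain` accepts arbitrary real estimates, so the truncated rows need not sum to `1`.
  have hS := hmain m hm0 (fun x i j => truncate η (p j) ((Mhat x).1 i j)) w hw0 S ?_
  · rw [EReal.coe_lt_coe_iff] at hS2
    have h1 := (mul_le_mul_of_nonneg_left hS hm0'.le)
    have h2 : (1 - τ) * C < m * S := hm.trans_le h1
    have h3 : (1 - τ) * C / (m + 1 : ℕ) ≤ (1 - τ) * C / m := by
      refine div_le_div_of_nonneg_left (mul_nonneg (by linarith) hC0.le) hm0' ?_
      push_cast
      linarith
    rw [← div_lt_iff₀' hm0'] at h2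
    linarith
  · intro P hP
    have hlow : ∀ a b, (1 - η) * p b ≤ P.trans a b := fun a b => by
      linarith [(abs_le.1 (hP a b)).1]
    have hup : ∀ a b, P.trans a b ≤ (1 + η) * p b := fun a b => by
      linarith [(abs_le.1 (hP a b)).2]
    have hmem : P ∈ chainsAtLeast k δ := fun a b => (hηδ b).trans (hlow a b)
    have hr : ∀ i, ((P.expect (m + 1) (fun x => ∑ j, (1 - ε) * (F / (2 * p j))
        * (P.trans i j - truncate η (p j) ((Mhat x).1 i j)) ^ 2) : ℝ) : EReal)
        ≤ stateRisk (fDiv f) P Mhat i := fun i => by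
      refine coe_expect_le_stateRisk fun x => fDiv_ge_of_terms (c := deriv f 1) (P.sum_trans i)
        (Matrix.sum_row_of_mem_rowStochastic (Mhat x).2 i) fun j => ?_
      exact hterm η hη0 hηη (p j) _ _ (hpos j) (hlow i j) (hup i j)
        (Matrix.nonneg_of_mem_rowStochastic (Mhat x).2)
    have h := hrisk P Mhat hP _ (fun i => P.expect_nonneg fun x => Finset.sum_nonneg fun j _ => ?_) hr
    · have h2 := (h.trans (le_iSup₂ (f := fun P (_ : P ∈ chainsAtLeast k δ) => risk P Mhat) P hmem)).trans
        hS1.le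
      rw [EReal.coe_le_coe_iff] at h2
      refine le_trans (le_of_eq ?_) h2
      refine Finset.sum_congr rfl fun i _ => ?_
      rw [P.expect_sum, Finset.mul_sum]
      refine Finset.sum_congr rfl fun j _ => ?_
      rw [P.expect_const_mul, hw]
      ring
    · have : 0 ≤ 1 - ε := by linarith
      have := hpos j
      positivity

theorem eventually_atTop_of_succ {Q : ℕ → Prop} (h : ∀ᶠ m in atTop, Q (m + 1)) :
    ∀ᶠ n in atTop, Q n := by
  rw [← map_add_atTop_eq_nat 1]
  exact h

/-- Take `p` uniform. Nearby chains have stationary masses at least `(1 - η) / k`, which serve as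
the weights `u`. -/
theorem eventually_minimaxWeightedRisk_ge {f : ℝ → ℝ} (hf : IsOrdinary f) {δ : ℝ} (hδ : 0 < δ)
    (hδk : δ < 1 / k) (hk : 2 ≤ k) {τ : ℝ} (hτ0 : 0 < τ) (hτ1 : τ < 1) :
    ∀ᶠ n : ℕ in atTop, (((1 - τ) * ((k - 1 : ℝ) * k * deriv (deriv f) 1 / (2 * n)) : ℝ) : EReal)
      ≤ minimaxWeightedRisk f (chainsAtLeast k δ) n := by
  have hk0 : (0 : ℝ) < k := by positivity
  have hk1 : (0 : ℝ) < k - 1 := by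
    have : (2 : ℝ) ≤ k := by exact_mod_cast hk
    linarith
  have hF := hf.deriv_two_pos
  have hp : (fun _ => 1 / k : Fin k → ℝ) ∈ stdSimplex ℝ (Fin k) :=
    ⟨fun _ => by positivity, by simp [hk0.ne']⟩
  obtain ⟨η, hη0, hη1, h⟩ := eventually_minimax_ge hf hp (fun _ => hδk) hδ.le hk
    (τ := τ / 2) (by positivity) (by linarith)
  have hsum : ∑ _i : Fin k, (1 - η) * (1 / k) / (1 / k : ℝ) = (1 - η) * k := by
    simp [hk0.ne']
    field_simp
  have h1 := h (fun _ => (1 - η) * (1 / k)) (fun _ => mul_nonneg (by linarith) (by positivity)) (by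
    rw [hsum]
    exact mul_pos (by linarith) hk0)
  refine eventually_atTop_of_succ ?_
  filter_upwards [h1] with m hm
  refine le_trans (EReal.coe_le_coe_iff.2 ?_)
    (hm (weightedRisk (fDiv f)) fun P Mhat hP r hr0 hr => ?_)
  · rw [hsum]
    calc _ = (1 - τ) * ((k - 1 : ℝ) * k * deriv (deriv f) 1 / (2 * (m + 1 : ℕ))) := rfl
      _ ≤ (1 - τ / 2) * (1 - η) * ((k - 1 : ℝ) * k * deriv (deriv f) 1 / (2 * (m + 1 : ℕ))) := by
        refine mul_le_mul_of_nonneg_right ?_ (by positivity)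
        nlinarith
      _ = _ := by field_simp
  · refine le_trans (EReal.coe_le_coe_iff.2 (Finset.sum_le_sum fun i _ =>
      mul_le_mul_of_nonneg_right ?_ (hr0 i))) (coe_sum_le_weightedRisk hr)
    refine P.le_stationary fun a => ?_
    linarith [(abs_le.1 (hP a i)).1]

theorem eventually_minimaxMaxRisk_ge_of_mem {f : ℝ → ℝ} (hf : IsOrdinary f) {p : Fin k → ℝ} {δ : ℝ}
    (hp : p ∈ stdSimplex ℝ (Fin k)) (hpδ : ∀ b, δ < p b) (hδ : 0 < δ) (hk : 2 ≤ k) (i₀ : Fin k)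
    {τ : ℝ} (hτ0 : 0 < τ) (hτ1 : τ < 1) :
    ∀ᶠ n : ℕ in atTop,
      (((1 - τ) * ((k - 1 : ℝ) * deriv (deriv f) 1 / (2 * n * p i₀)) : ℝ) : EReal)
      ≤ minimaxMaxRisk f (chainsAtLeast k δ) n := by
  have hpi : 0 < p i₀ := hδ.trans (hpδ i₀)
  obtain ⟨η, hη0, hη1, h⟩ := eventually_minimax_ge hf hp hpδ hδ.le hk hτ0 hτ1
  have hsum : ∑ i, (Pi.single i₀ 1 : Fin k → ℝ) i / p i = 1 / p i₀ := by
    rw [Finset.sum_eq_single i₀ (fun i _ hi => by simp [hi]) (by simp), Pi.single_eq_same]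
  have h1 := h (Pi.single i₀ 1) (fun i => by
    by_cases hi : i = i₀
    · subst hi; simp
    · simp [hi]) (by
    rw [hsum]
    positivity)
  refine eventually_atTop_of_succ ?_
  filter_upwards [h1] with m hm
  refine le_trans (EReal.coe_le_coe_iff.2 (le_of_eq ?_))
    (hm (maxRisk (fDiv f)) fun P Mhat hP r hr0 hr => ?_)
  · rw [hsum]
    field_simp
  · refine le_trans (le_of_eq ?_) ((hr i₀).trans (le_iSup (stateRisk (fDiv f) P Mhat) i₀))
    rw [Finset.sum_eq_single i₀ (fun i _ hi => by simp [hi]) (by simp), Pi.single_eq_same, one_mul]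

/-- One state gets mass `δ + s` and the others share the rest, still above `δ` because `δ k < 1`. As
`s → 0` the constant tends to `(k - 1) / δ`, strictly more than `(1 - δ) (k - 2) / δ`; this room
absorbs every error, so no `o(1)` remains. -/
theorem eventually_minimaxMaxRisk_ge {f : ℝ → ℝ} (hf : IsOrdinary f) {δ : ℝ} (hδ : 0 < δ)
    (hδk : δ < 1 / k) (hk : 2 ≤ k) :
    ∀ᶠ n : ℕ in atTop,
      (((1 - δ) * ((k - 2 : ℝ) * deriv (deriv f) 1 / (2 * n * δ)) : ℝ) : EReal)
      ≤ minimaxMaxRisk f (chainsAtLeast k δ) n := by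
  have hk2 : (2 : ℝ) ≤ k := by exact_mod_cast hk
  have hk1 : (0 : ℝ) < k - 1 := by linarith
  have hF := hf.deriv_two_pos
  have hδ' : δ * k < 1 := by rwa [lt_div_iff₀ (by linarith)] at hδk
  obtain ⟨s, hs0, hs1, hs2, hs3⟩ : ∃ s, 0 < s ∧ s < 1 ∧ δ < (1 - δ - s) / (k - 1) ∧
      (1 - δ) * (k - 2) / δ < (1 - s) * (k - 1) / (δ + s) := by
    have h1 : Tendsto (fun s : ℝ => (1 - δ - s) / (k - 1)) (𝓝[>] 0) (𝓝 ((1 - δ - 0) / (k - 1))) :=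
      Continuous.continuousWithinAt (by fun_prop)
    have h2 : Tendsto (fun s : ℝ => (1 - s) * (k - 1) / (δ + s)) (𝓝[>] 0)
        (𝓝 ((1 - 0) * (k - 1) / (δ + 0))) := by
      refine ContinuousAt.continuousWithinAt (ContinuousAt.div (by fun_prop) (by fun_prop) ?_)
      rw [add_zero]
      exact hδ.ne'
    have e1 := h1.eventually_const_lt (u := δ) (by
      rw [lt_div_iff₀ hk1]
      linarith)
    have e2 := h2.eventually_const_lt (u := (1 - δ) * (k - 2) / δ) (by
      rw [add_zero, div_lt_div_iff_of_pos_right hδ]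
      nlinarith)
    obtain ⟨s, ⟨hs2, hs3⟩, hs⟩ := ((e1.and e2).and (Ioo_mem_nhdsGT one_pos)).exists
    exact ⟨s, hs.1, hs.2, hs2, hs3⟩
  let i₀ : Fin k := ⟨0, by omega⟩
  set p : Fin k → ℝ := fun j => if j = i₀ then δ + s else (1 - δ - s) / (k - 1) with hpdef
  have hpδ : ∀ b, δ < p b := fun b => by
    simp only [hpdef]
    split_ifs <;> linarith
  have hp : p ∈ stdSimplex ℝ (Fin k) := by
    refine ⟨fun b => (hδ.trans (hpδ b)).le, ?_⟩
    have : ∀ j, p j = (1 - δ - s) / (k - 1)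
        + if j = i₀ then δ + s - (1 - δ - s) / (k - 1) else 0 := fun j => by
      simp only [hpdef]
      split_ifs <;> ring
    simp only [this, Finset.sum_add_distrib]
    simp
    field_simp
    ring
  have hpi : p i₀ = δ + s := if_pos rfl
  filter_upwards [eventually_minimaxMaxRisk_ge_of_mem hf hp hpδ hδ hk i₀ hs0 hs1] with n hn
  refine le_trans (EReal.coe_le_coe_iff.2 ?_) hn
  rw [hpi]
  have e1 : (1 - δ) * ((k - 2 : ℝ) * deriv (deriv f) 1 / (2 * n * δ))
      = (1 - δ) * (k - 2) / δ * (deriv (deriv f) 1 / (2 * n)) := by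
    field_simp
  have e2 : (1 - s) * ((k - 1 : ℝ) * deriv (deriv f) 1 / (2 * n * (δ + s)))
      = (1 - s) * (k - 1) / (δ + s) * (deriv (deriv f) 1 / (2 * n)) := by
    field_simp
  rw [e1, e2]
  exact mul_le_mul_of_nonneg_right hs3.le (by positivity)

end risk

/-! ### Transition counts, their deviations and the visit frequencies -/

section counts

variable {k : ℕ}

/-- The number of transitions of a path that leave the state `i`. -/
def visits (i : Fin k) {m : ℕ} (x : Fin (m + 1) → Fin k) : ℝ :=
  transSum (fun a _ => if a = i then 1 else 0) x

/-- The number of transitions of a path from `i` to `j`. -/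
def transCount (i j : Fin k) {m : ℕ} (x : Fin (m + 1) → Fin k) : ℝ :=
  transSum (fun a b => if a = i then if b = j then 1 else 0 else 0) x

/-- The deviation of the number of transitions from `i` to `j` from its compensator. -/
def transDev (M : Matrix (Fin k) (Fin k) ℝ) (i j : Fin k) {m : ℕ} (x : Fin (m + 1) → Fin k) : ℝ :=
  transSum (fun a b => if a = i then (if b = j then 1 else 0) - M i j else 0) x

variable {m : ℕ} (x : Fin (m + 1) → Fin k) (M : Matrix (Fin k) (Fin k) ℝ) (i j : Fin k)

theorem transDev_eq : transDev M i j x = transCount i j x - visits i x * M i j := by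
  unfold transDev transCount visits transSum
  rw [Finset.sum_mul, ← Finset.sum_sub_distrib]
  refine Finset.sum_congr rfl fun t _ => ?_
  dsimp only
  split_ifs <;> ring

theorem sum_transCount : ∑ j, transCount i j x = visits i x := by
  unfold transCount visits transSum
  rw [Finset.sum_comm]
  refine Finset.sum_congr rfl fun t _ => ?_
  dsimp only
  split_ifs <;> simp

theorem sum_visits : ∑ i, visits i x = m := by
  unfold visits transSum
  rw [Finset.sum_comm]
  simp

theorem sum_transCount_left : ∑ i, transCount i j x
    = visits j x + (if x (Fin.last m) = j then 1 else 0) - (if x 0 = j then 1 else 0) := by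
  have h : ∑ i, transCount i j x = ∑ t : Fin m, if x t.succ = j then (1 : ℝ) else 0 := by
    unfold transCount transSum
    rw [Finset.sum_comm]
    simp
  have h1 := Fin.sum_univ_succ fun t => if x t = j then (1 : ℝ) else 0
  have h2 := Fin.sum_univ_castSucc fun t => if x t = j then (1 : ℝ) else 0
  rw [h]
  unfold visits transSum
  linarith

/-- Arrivals at `j` and departures from `j` differ only at the two ends of the path. -/
theorem abs_visits_balance_le :
    |∑ i, visits i x * M i j - visits j x + ∑ i, transDev M i j x| ≤ 1 := by
  have h : ∑ i, visits i x * M i j - visits j x + ∑ i, transDev M i j x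
      = (if x (Fin.last m) = j then 1 else 0) - (if x 0 = j then 1 else 0) := by
    simp only [transDev_eq, Finset.sum_sub_distrib, sum_transCount_left]
    ring
  rw [h]
  split_ifs <;> norm_num

/-- A matrix with entries at least `δ` contracts vectors of sum zero. -/
theorem sum_abs_le_of_vecMul {δ : ℝ} (hM : M ∈ Matrix.rowStochastic ℝ (Fin k))
    (hδ : ∀ i j, δ ≤ M i j) {w : Fin k → ℝ} (hw : ∑ i, w i = 0) :
    k * δ * ∑ i, |w i| ≤ ∑ j, |∑ i, w i * M i j - w j| := by
  have h1 : ∀ j, |w j| ≤ |∑ i, w i * M i j - w j| + ∑ i, |w i| * (M i j - δ) := by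
    intro j
    -- As `w` sums to zero, `δ` can be subtracted from all entries; the matrix left is nonnegative
    -- with row sums `1 - k δ`.
    have e : ∑ i, w i * M i j = ∑ i, w i * (M i j - δ) := by
      simp only [mul_sub, Finset.sum_sub_distrib, ← Finset.sum_mul, hw]
      ring
    have h2 : |∑ i, w i * M i j| ≤ ∑ i, |w i| * (M i j - δ) := by
      rw [e]
      refine (Finset.abs_sum_le_sum_abs _ _).trans (le_of_eq (Finset.sum_congr rfl fun i _ => ?_))
      rw [abs_mul, abs_of_nonneg (sub_nonneg.2 (hδ i j))]
    have h3 := abs_sub_abs_le_abs_sub (w j) (∑ i, w i * M i j)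
    rw [abs_sub_comm] at h3
    linarith
  have h2 := Finset.sum_le_sum fun j (_ : j ∈ Finset.univ) => h1 j
  rw [Finset.sum_add_distrib, Finset.sum_comm] at h2
  have h3 : ∀ i, ∑ j, |w i| * (M i j - δ) = |w i| * (1 - k * δ) := fun i => by
    rw [← Finset.mul_sum, Finset.sum_sub_distrib, Matrix.sum_row_of_mem_rowStochastic hM]
    simp
  simp only [h3, ← Finset.sum_mul] at h2
  linarith

variable {P : MarkovChain k} {δ : ℝ}

/-- The contraction is applied to `v - s π`, which sums to zero and has the same defect as `v` by
stationarity. The factor `k` cancels against the `k` coordinate defects. -/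
theorem MarkovChain.abs_sub_stationary_le (hδ0 : 0 < δ) (hP : P ∈ chainsAtLeast k δ)
    {v : Fin k → ℝ} {s c : ℝ} (hs : ∑ i, v i = s)
    (hc : ∀ j, |∑ i, v i * P.trans i j - v j| ≤ c) (i : Fin k) :
    |v i - s * P.stationary i| ≤ c / δ := by
  have hk : (0 : ℝ) < k := by
    have := Fin.pos i
    exact_mod_cast this
  have h := sum_abs_le_of_vecMul P.trans P.trans_mem hP (w := fun i => v i - s * P.stationary i) (by
    rw [Finset.sum_sub_distrib, ← Finset.mul_sum, P.sum_stationary, hs]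
    ring)
  have h2 : ∀ j, |∑ i, (v i - s * P.stationary i) * P.trans i j - (v j - s * P.stationary j)| ≤ c := by
    intro j
    have e : ∑ i, (v i - s * P.stationary i) * P.trans i j - (v j - s * P.stationary j)
        = ∑ i, v i * P.trans i j - v j := by
      simp only [sub_mul, Finset.sum_sub_distrib, mul_assoc, ← Finset.mul_sum,
        P.sum_stationary_mul]
      ring
    rw [e]
    exact hc j
  have h3 := h.trans (Finset.sum_le_sum fun j _ => h2 j)
  simp only [Finset.sum_const, Finset.card_univ, Fintype.card_fin, nsmul_eq_mul] at h3
  have h4 : |v i - s * P.stationary i| ≤ ∑ i, |v i - s * P.stationary i| :=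
    Finset.single_le_sum (f := fun i => |v i - s * P.stationary i|) (fun i _ => abs_nonneg _)
      (Finset.mem_univ i)
  rw [le_div_iff₀ hδ0]
  have h5 : δ * ∑ i, |v i - s * P.stationary i| ≤ c := by
    rw [mul_assoc] at h3
    exact le_of_mul_le_mul_left h3 hk
  nlinarith

variable (P)

theorem MarkovChain.sum_trans_mul_dev (a : Fin k) :
    ∑ b, P.trans a b * (if a = i then (if b = j then 1 else 0) - P.trans i j else 0) = 0 := by
  by_cases h : a = i
  · subst h
    simp [mul_sub, ← Finset.sum_mul, P.sum_trans]
  · simp [h]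

theorem MarkovChain.expect_transDev : P.expect (m + 1) (transDev P.trans i j) = 0 := by
  unfold transDev
  rw [P.expect_transSum]
  simp only [P.sum_trans_mul_dev]
  simp [transSum, expect]

theorem MarkovChain.expect_transDev_sq : P.expect (m + 1) (fun x => transDev P.trans i j x ^ 2)
    = P.trans i j * (1 - P.trans i j) * P.expect (m + 1) (visits i) := by
  unfold transDev
  rw [expect_transSum_sq (P.sum_trans_mul_dev i j), ← P.expect_const_mul]
  congr 1
  funext x
  unfold visits transSum
  rw [Finset.mul_sum]
  refine Finset.sum_congr rfl fun t _ => ?_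
  by_cases h : x t.castSucc = i
  · simp only [h, if_true]
    have : ∀ b, P.trans i b * ((if b = j then 1 else 0) - P.trans i j) ^ 2
        = P.trans i b * P.trans i j ^ 2 + if b = j then P.trans i j * (1 - 2 * P.trans i j) else 0 := by
      intro b
      split_ifs with hb
      · subst hb; ring
      · ring
    simp only [this, Finset.sum_add_distrib, ← Finset.sum_mul, P.sum_trans]
    simp
    ring
  · simp [h]

theorem MarkovChain.expect_transDev_pow_four_le :
    P.expect (m + 1) (fun x => transDev P.trans i j x ^ 4) ≤ 11 * (m : ℝ) ^ 2 := by
  refine expect_transSum_pow_four_le (P.sum_trans_mul_dev i j) (fun a b => ?_) m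
  have h0 := P.trans_nonneg i j
  have h1 := P.trans_le_one i j
  rw [abs_le]
  split_ifs <;> constructor <;> linarith

variable {P}

/-- The deviations have mean zero, so the expected visits satisfy the stationarity equation up to a
defect of `1`, whatever the initial law. -/
theorem MarkovChain.expect_visits_le_stationary (hδ0 : 0 < δ) (hP : P ∈ chainsAtLeast k δ) :
    P.expect (m + 1) (visits i) ≤ m * P.stationary i + 1 / δ := by
  have h := P.abs_sub_stationary_le hδ0 hP (v := fun i => P.expect (m + 1) (visits i)) (s := m)
    (c := 1) (by
      rw [← P.expect_sum]
      simp only [sum_visits]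
      exact P.expect_const m _) (fun j => by
      have e : ∑ i, P.expect (m + 1) (visits i) * P.trans i j - P.expect (m + 1) (visits j)
          = P.expect (m + 1) fun x => ∑ i, visits i x * P.trans i j - visits j x
            + ∑ i, transDev P.trans i j x := by
        have e1 : ∀ x : Fin (m + 1) → Fin k, ∑ i, visits i x * P.trans i j - visits j x
            + ∑ i, transDev P.trans i j x = (∑ i, P.trans i j * visits i x) + ((-1) * visits j x
            + ∑ i, transDev P.trans i j x) := fun x => by
          simp only [mul_comm]
          ring
        simp only [e1, P.expect_add, P.expect_sum, P.expect_const_mul]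
        rw [Finset.sum_eq_zero (fun i _ => P.expect_transDev i j)]
        simp only [mul_comm]
        ring
      rw [e, abs_le]
      constructor
      · rw [← P.expect_const m (-1)]
        exact expect_mono fun x => (abs_le.1 (abs_visits_balance_le x P.trans j)).1
      · rw [← P.expect_const m 1]
        exact expect_mono fun x => (abs_le.1 (abs_visits_balance_le x P.trans j)).2) i
  linarith [(abs_le.1 h).2]

/-- The pathwise version: the defect is at most `1 + k σ m`, and `1 ≤ σ m` absorbs the boundary
term. -/
theorem abs_visits_sub_le (hδ0 : 0 < δ) (hP : P ∈ chainsAtLeast k δ) {σ : ℝ} (hm : 1 ≤ σ * m)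
    (hdev : ∀ a b, |transDev P.trans a b x| ≤ σ * m) :
    |visits i x - m * P.stationary i| ≤ (k + 1) * (σ * m) / δ := by
  refine P.abs_sub_stationary_le hδ0 hP (v := fun i => visits i x) (sum_visits x) (fun j => ?_) i
  have h1 := abs_visits_balance_le x P.trans j
  have h2 : |∑ i, transDev P.trans i j x| ≤ k * (σ * m) := by
    refine (Finset.abs_sum_le_sum_abs _ _).trans ((Finset.sum_le_sum fun i _ => hdev i j).trans ?_)
    simp
  rw [abs_le] at h1 h2 ⊢
  constructor <;> linarith [h1.1, h1.2, h2.1, h2.2]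

end counts

/-! ### The empirical estimator and its loss on typical paths -/

section estimator

variable {k : ℕ}

open Classical in
/-- The empirical transition frequencies from `i`, or the uniform distribution if one of the
frequencies is less than `c`. -/
noncomputable def empiricalRow (c : ℝ) {m : ℕ} (x : Fin (m + 1) → Fin k) (i j : Fin k) : ℝ :=
  if 0 < visits i x ∧ ∀ l, c ≤ transCount i l x / visits i x then transCount i j x / visits i x
  else 1 / k

theorem le_empiricalRow {c : ℝ} (hc : c ≤ 1 / k) {m : ℕ} (x : Fin (m + 1) → Fin k) (i j : Fin k) :
    c ≤ empiricalRow c x i j := by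
  unfold empiricalRow
  split_ifs with h
  · exact h.2 j
  · exact hc

theorem sum_empiricalRow (c : ℝ) {m : ℕ} (x : Fin (m + 1) → Fin k) (i : Fin k) :
    ∑ j, empiricalRow c x i j = 1 := by
  unfold empiricalRow
  split_ifs with h
  · rw [← Finset.sum_div, sum_transCount, div_self h.1.ne']
  · have := (Fin.pos i).ne'
    simp [this]

/-- The estimator of the transition matrix by empirical frequencies. -/
noncomputable def empiricalEstimator {c : ℝ} (hc0 : 0 ≤ c) (hc : c ≤ 1 / k) (m : ℕ) :
    Estimator k (m + 1) := fun x =>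
  ⟨empiricalRow c x, Matrix.mem_rowStochastic_iff_sum.2
    ⟨fun i j => hc0.trans (le_empiricalRow hc x i j), sum_empiricalRow c x⟩⟩

theorem fDiv_of_pos {f : ℝ → ℝ} {p q : Fin k → ℝ} (hp : ∀ j, 0 < p j) (hq : ∀ j, 0 < q j)
    (hp1 : ∑ j, p j = 1) (hq1 : ∑ j, q j = 1) :
    fDiv f p q = ((∑ j, q j * excess f (p j / q j) : ℝ) : EReal) := by
  have e : ∑ j, q j * excess f (p j / q j)
      = ∑ j, (deriv f 1 * (p j - q j) + q j * excess f (p j / q j)) := by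
    rw [Finset.sum_add_distrib, ← Finset.mul_sum, Finset.sum_sub_distrib, hp1, hq1]
    ring
  rw [e, EReal.coe_sum_real]
  exact Finset.sum_congr rfl fun j _ => fDivTerm_of_pos (hp j) (hq j)

theorem IsOrdinary.exists_excess_le {f : ℝ → ℝ} (hf : IsOrdinary f) {a b : ℝ} (ha : 0 < a) :
    ∃ C, 0 ≤ C ∧ ∀ y ∈ Set.Icc a b, excess f y ≤ C := by
  have hcont : ContinuousOn (excess f) (Set.Icc a b) := by
    have h : ContinuousOn f (Set.Icc a b) :=
      hf.contDiffOn.continuousOn.mono fun y hy => ha.trans_le hy.1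
    unfold excess
    fun_prop
  obtain ⟨C, hC⟩ := isCompact_Icc.exists_bound_of_continuousOn hcont
  exact ⟨max C 0, le_max_right _ _, fun y hy =>
    ((le_abs_self _).trans (hC y hy)).trans (le_max_left _ _)⟩

/-- If all transition counts are close to their compensators, the divergence of the empirical row
is at most a multiple of its `χ²`-statistic. -/
theorem sum_excess_le_of_dev {f : ℝ → ℝ} {P : MarkovChain k} {δ σ ε : ℝ} (hδ0 : 0 < δ)
    (hP : P ∈ chainsAtLeast k δ) (hε : 0 < ε) (hF : 0 < deriv (deriv f) 1) {ρ : ℝ}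
    (hρ : ∀ y, |y - 1| < ρ → excess f y ≤ (1 + ε) * (deriv (deriv f) 1 / 2) * (y - 1) ^ 2)
    (hσ0 : 0 < σ) (hσ1 : 4 * σ / δ ^ 2 < ρ) (hσ2 : (k + 1) * σ / δ ^ 2 ≤ 1 / 2)
    (hσ3 : 2 * σ / δ ≤ δ / 2) {m : ℕ} (hm : 1 ≤ σ * m) (x : Fin (m + 1) → Fin k)
    (hdev : ∀ a b, |transDev P.trans a b x| ≤ σ * m) (i : Fin k) :
    ∑ j, empiricalRow (δ / 2) x i j * excess f (P.trans i j / empiricalRow (δ / 2) x i j)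
      ≤ (1 + ε) * (1 + 4 * σ / δ ^ 2) / (1 - (k + 1) * σ / δ ^ 2) ^ 2 * (deriv (deriv f) 1 / 2)
        * ∑ j, transDev P.trans i j x ^ 2 / P.trans i j / (m * P.stationary i) ^ 2 := by
  have hm0 : (0 : ℝ) < m := by
    by_contra! h
    nlinarith
  have hπ : δ ≤ P.stationary i := P.le_stationary fun a => hP a i
  have hvis := abs_visits_sub_le x i hδ0 hP hm hdev
  set π := P.stationary i
  set N := visits i x
  -- The relative error of the visit count against `m π`; `ζ ≤ 1 / 2` keeps the count at least `m δ
  -- / 2`.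
  set ζ := (k + 1) * σ / δ ^ 2 with hζ
  have hζ0 : 0 < ζ := by positivity
  have hN : (1 - ζ) * (m * π) ≤ N := by
    have h1 := (abs_le.1 hvis).1
    have h2 : (k + 1) * (σ * m) / δ = ζ * (m * δ) := by
      rw [hζ]
      field_simp
    have h3 : ζ * (m * δ) ≤ ζ * (m * π) := by gcongr
    linarith
  have hN2 : m * δ / 2 ≤ N := by
    have h1 : 1 / 2 * (m * δ) ≤ (1 - ζ) * (m * π) := by
      refine mul_le_mul (by linarith) ?_ (by positivity) (by linarith)
      gcongr
    linarith
  have hN0 : 0 < N := lt_of_lt_of_le (by positivity) hN2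
  have hemp : ∀ j, transCount i j x / N - P.trans i j = transDev P.trans i j x / N := fun j => by
    rw [transDev_eq, sub_div, mul_div_cancel_left₀ _ hN0.ne']
  have hclose : ∀ j, |transCount i j x / N - P.trans i j| ≤ 2 * σ / δ := fun j => by
    rw [hemp, abs_div, abs_of_pos hN0, div_le_div_iff₀ hN0 hδ0]
    calc |transDev P.trans i j x| * δ ≤ σ * m * δ := by
          gcongr
          exact hdev i j
      _ = 2 * σ * (m * δ / 2) := by ring
      _ ≤ _ := by gcongr
  -- Hence the fallback to the uniform row is not triggered on such paths.
  have hlow : ∀ j, δ / 2 ≤ transCount i j x / N := fun j => by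
    linarith [(abs_le.1 (hclose j)).1, hP i j]
  have hrow : ∀ j, empiricalRow (δ / 2) x i j = transCount i j x / N := fun j =>
    if_pos ⟨hN0, hlow⟩
  simp only [hrow]
  rw [Finset.mul_sum]
  refine Finset.sum_le_sum fun j _ => ?_
  have hq := hlow j
  have hpq := hclose j
  have hS := hemp j
  set q := transCount i j x / N
  have hp : 0 < P.trans i j := hδ0.trans_le (hP i j)
  have hq0 : 0 < q := by linarith
  have hratio : P.trans i j / q - 1 = -(q - P.trans i j) / q := by
    field_simp
    ring
  have hratio2 : |P.trans i j / q - 1| ≤ 4 * σ / δ ^ 2 := by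
    rw [hratio, abs_div, abs_neg, abs_of_pos hq0, div_le_div_iff₀ hq0 (by positivity)]
    rw [le_div_iff₀ hδ0] at hpq
    calc |q - P.trans i j| * δ ^ 2 = |q - P.trans i j| * δ * δ := by ring
      _ ≤ 2 * σ * δ := by gcongr
      _ = 4 * σ * (δ / 2) := by ring
      _ ≤ _ := by gcongr
  have hqinv : q⁻¹ ≤ (1 + 4 * σ / δ ^ 2) / P.trans i j := by
    rw [le_div_iff₀ hp, inv_mul_eq_div]
    linarith [(abs_le.1 hratio2).2]
  have hex := hρ _ (hratio2.trans_lt hσ1)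
  have hζ1 : 0 < 1 - ζ := by linarith
  have hπ0 : 0 < π := hδ0.trans_le hπ
  have hNsq : transDev P.trans i j x ^ 2 / N ^ 2
      ≤ transDev P.trans i j x ^ 2 / ((1 - ζ) * (m * π)) ^ 2 := by gcongr
  calc q * excess f (P.trans i j / q)
      ≤ q * ((1 + ε) * (deriv (deriv f) 1 / 2) * (P.trans i j / q - 1) ^ 2) := by gcongr
    _ = (1 + ε) * (deriv (deriv f) 1 / 2) * (transDev P.trans i j x ^ 2 / N ^ 2) * q⁻¹ := by
      rw [hratio, hS]
      field_simp
    _ ≤ (1 + ε) * (deriv (deriv f) 1 / 2)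
        * (transDev P.trans i j x ^ 2 / ((1 - ζ) * (m * π)) ^ 2)
        * ((1 + 4 * σ / δ ^ 2) / P.trans i j) := by gcongr
    _ = _ := by
      rw [mul_pow]
      field_simp

end estimator

/-! ### The upper bounds -/

section upperBound

variable {k : ℕ} {f : ℝ → ℝ} {δ : ℝ}

/-- A crude bound for atypical paths: the threshold `δ / 2` confines every likelihood ratio to `[δ,
2 / δ]`. -/
theorem sum_excess_empiricalRow_le {C : ℝ} {P : MarkovChain k} (hδ0 : 0 < δ) (hδk : δ < 1 / k)
    (hP : P ∈ chainsAtLeast k δ) (hC : ∀ y ∈ Set.Icc δ (2 / δ), excess f y ≤ C) {m : ℕ}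
    (x : Fin (m + 1) → Fin k) (i : Fin k) :
    ∑ j, empiricalRow (δ / 2) x i j * excess f (P.trans i j / empiricalRow (δ / 2) x i j) ≤ C := by
  have hq : ∀ j, δ / 2 ≤ empiricalRow (δ / 2) x i j := le_empiricalRow (by linarith) x i
  have hq0 : ∀ j, 0 < empiricalRow (δ / 2) x i j := fun j => by linarith [hq j]
  have hq1 : ∀ j, empiricalRow (δ / 2) x i j ≤ 1 := fun j => by
    rw [← sum_empiricalRow (δ / 2) x i]
    exact Finset.single_le_sum (fun l _ => (hq0 l).le) (Finset.mem_univ j)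
  calc _ ≤ ∑ j, empiricalRow (δ / 2) x i j * C := by
        refine Finset.sum_le_sum fun j _ => mul_le_mul_of_nonneg_left (hC _ ⟨?_, ?_⟩) (hq0 j).le
        · rw [le_div_iff₀ (hq0 j)]
          nlinarith [hq1 j, hP i j]
        · rw [div_le_div_iff₀ (hq0 j) hδ0]
          nlinarith [hq j, P.trans_le_one i j]
    _ = C := by rw [← Finset.sum_mul, sum_empiricalRow, one_mul]

theorem exists_stateRisk_le (hf : IsOrdinary f) (hδ0 : 0 < δ) (hδk : δ < 1 / k) {ε : ℝ}
    (hε : 0 < ε) : ∃ B C : ℝ, B < 1 + ε ∧ 0 ≤ B ∧ ∀ᶠ m : ℕ in atTop,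
      ∃ Mhat : Estimator k (m + 1), ∀ P ∈ chainsAtLeast k δ, ∀ i,
        stateRisk (fDiv f) P Mhat i ≤ ((B * (deriv (deriv f) 1 / 2)
          * ((k - 1) * (m * P.stationary i + 1 / δ) / (m * P.stationary i) ^ 2) + C / m ^ 2 : ℝ)
            : EReal) := by
  have hF := hf.deriv_two_pos
  obtain ⟨ρ, hρ0, hρ⟩ := hf.exists_excess_bounds (half_pos hε)
  obtain ⟨C₀, hC₀, hC⟩ := hf.exists_excess_le (b := 2 / δ) hδ0
  -- All these conditions hold strictly at `σ = 0`, hence for small `σ > 0` by continuity.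
  obtain ⟨σ, hσ0, hσ1, hσ2, hσ3, hσ4⟩ : ∃ σ, 0 < σ ∧ 4 * σ / δ ^ 2 < ρ ∧
      (k + 1) * σ / δ ^ 2 < 1 / 2 ∧ 2 * σ / δ < δ / 2 ∧
      (1 + ε / 2) * (1 + 4 * σ / δ ^ 2) / (1 - (k + 1) * σ / δ ^ 2) ^ 2 < 1 + ε := by
    have ev : ∀ (g : ℝ → ℝ) (c : ℝ), ContinuousAt g 0 → g 0 < c → ∀ᶠ σ in 𝓝[>] 0, g σ < c :=
      fun g c hg h => (hg.tendsto.mono_left nhdsWithin_le_nhds).eventually_lt_const h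
    have e1 := ev (fun σ => 4 * σ / δ ^ 2) ρ (by fun_prop) (by simpa using hρ0)
    have e2 := ev (fun σ => (k + 1) * σ / δ ^ 2) (1 / 2) (by fun_prop) (by simp)
    have e3 := ev (fun σ => 2 * σ / δ) (δ / 2) (by fun_prop) (by simpa using hδ0)
    have e4 := ev (fun σ => (1 + ε / 2) * (1 + 4 * σ / δ ^ 2) / (1 - (k + 1) * σ / δ ^ 2) ^ 2)
      (1 + ε) (ContinuousAt.div (by fun_prop) (by fun_prop) (by simp)) (by simp; linarith)
    obtain ⟨σ, ⟨⟨h1, h2⟩, h3, h4⟩, h5⟩ :=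
      (((e1.and e2).and (e3.and e4)).and self_mem_nhdsWithin).exists
    exact ⟨σ, h5, h1, h2, h3, h4⟩
  refine ⟨_, C₀ * (k * (k * 11)) / σ ^ 4, hσ4, by positivity, ?_⟩
  set B := (1 + ε / 2) * (1 + 4 * σ / δ ^ 2) / (1 - (k + 1) * σ / δ ^ 2) ^ 2 with hB
  have hB0 : 0 ≤ B := by positivity
  have hlarge : ∀ᶠ m : ℕ in atTop, 1 ≤ σ * m := by
    have : Tendsto (fun m : ℕ => σ * (m : ℝ)) atTop atTop :=
      tendsto_natCast_atTop_atTop.const_mul_atTop hσ0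
    exact this.eventually_ge_atTop 1
  filter_upwards [hlarge] with m hm
  have hm0 : (0 : ℝ) < m := by
    by_contra! h
    nlinarith
  refine ⟨empiricalEstimator (c := δ / 2) (by positivity) (by linarith) m, fun P hP i => ?_⟩
  have hπ : δ ≤ P.stationary i := P.le_stationary fun a => hP a i
  have hπ0 : 0 < P.stationary i := hδ0.trans_le hπ
  have hMpos : ∀ a b, 0 < P.trans a b := fun a b => hδ0.trans_le (hP a b)
  have hpt : ∀ x : Fin (m + 1) → Fin k,
      ∑ j, empiricalRow (δ / 2) x i j * excess f (P.trans i j / empiricalRow (δ / 2) x i j)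
      ≤ B * (deriv (deriv f) 1 / 2) / (m * P.stationary i) ^ 2
          * (∑ j, 1 / P.trans i j * transDev P.trans i j x ^ 2)
        + C₀ / (σ * m) ^ 4 * ∑ a, ∑ b, transDev P.trans a b x ^ 4 := by
    intro x
    have h1 : 0 ≤ B * (deriv (deriv f) 1 / 2) / (m * P.stationary i) ^ 2
          * (∑ j, 1 / P.trans i j * transDev P.trans i j x ^ 2) :=
      mul_nonneg (by positivity) (Finset.sum_nonneg fun j _ =>
        mul_nonneg (one_div_pos.2 (hMpos i j)).le (sq_nonneg _))
    have h4 : ∀ a b, 0 ≤ transDev P.trans a b x ^ 4 := fun a b => by positivity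
    by_cases hdev : ∀ a b, |transDev P.trans a b x| ≤ σ * m
    · have h2 : 0 ≤ C₀ / (σ * m) ^ 4 * ∑ a, ∑ b, transDev P.trans a b x ^ 4 :=
        mul_nonneg (by positivity) (Finset.sum_nonneg fun a _ => Finset.sum_nonneg fun b _ => h4 a b)
      refine le_add_of_le_of_nonneg ((sum_excess_le_of_dev hδ0 hP (half_pos hε) hF
        (fun y hy => (hρ y hy).2) hσ0 hσ1 hσ2.le hσ3.le hm x hdev i).trans (le_of_eq ?_)) h2
      rw [Finset.mul_sum, Finset.mul_sum]
      exact Finset.sum_congr rfl fun j _ => by ring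
    -- Some deviation exceeds `σ m`, so the sum of fourth powers over `(σ m)^4` is at least `1`:
    -- Markov's inequality, pointwise.
    · push Not at hdev
      obtain ⟨a, b, hab⟩ := hdev
      refine (sum_excess_empiricalRow_le hδ0 hδk hP hC x i).trans (le_add_of_nonneg_of_le h1 ?_)
      rw [div_mul_eq_mul_div, le_div_iff₀ (by positivity)]
      refine mul_le_mul_of_nonneg_left ?_ hC₀
      calc (σ * m) ^ 4 ≤ |transDev P.trans a b x| ^ 4 := by gcongr
        _ = transDev P.trans a b x ^ 4 := by
          rw [← abs_pow, abs_of_nonneg (h4 a b)]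
        _ ≤ _ := (Finset.single_le_sum (f := fun b => transDev P.trans a b x ^ 4)
              (fun b _ => h4 a b) (Finset.mem_univ b)).trans
            (Finset.single_le_sum (f := fun a => ∑ b, transDev P.trans a b x ^ 4)
              (fun a _ => Finset.sum_nonneg fun b _ => h4 a b) (Finset.mem_univ a))
  have hq0 : ∀ (x : Fin (m + 1) → Fin k) j, 0 < empiricalRow (δ / 2) x i j := fun x j =>
    (half_pos hδ0).trans_le (le_empiricalRow (by linarith) x i j)
  refine (stateRisk_le_coe_expect fun x => (fDiv_of_pos (hMpos i) (hq0 x) (P.sum_trans i)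
    (sum_empiricalRow _ x i)).le.trans (EReal.coe_le_coe_iff.2 (hpt x))).trans
      (EReal.coe_le_coe_iff.2 ?_)
  simp only [P.expect_add, P.expect_const_mul, P.expect_sum, P.expect_transDev_sq]
  refine add_le_add ?_ ?_
  -- The variance `M_ij (1 - M_ij)` divided by `M_ij` sums over `j` to `k - 1`.
  · have e : ∑ j, 1 / P.trans i j * (P.trans i j * (1 - P.trans i j) * P.expect (m + 1) (visits i))
        = (k - 1) * P.expect (m + 1) (visits i) := by
      have : ∀ j, 1 / P.trans i j * (P.trans i j * (1 - P.trans i j) * P.expect (m + 1) (visits i))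
          = (1 - P.trans i j) * P.expect (m + 1) (visits i) := fun j => by
        have := (hMpos i j).ne'
        field_simp
      simp only [this, ← Finset.sum_mul, Finset.sum_sub_distrib, P.sum_trans]
      simp
    rw [e, div_mul_eq_mul_div, mul_div_assoc]
    have hk1 : (0 : ℝ) ≤ k - 1 := by
      have : (1 : ℝ) ≤ k := by exact_mod_cast Fin.pos i
      linarith
    gcongr
    exact P.expect_visits_le_stationary i hδ0 hP
  · calc _ ≤ C₀ / (σ * m) ^ 4 * ∑ _a : Fin k, ∑ _b : Fin k, 11 * (m : ℝ) ^ 2 := by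
          refine mul_le_mul_of_nonneg_left (Finset.sum_le_sum fun a _ => Finset.sum_le_sum fun b _ =>
            P.expect_transDev_pow_four_le a b) (by positivity)
      _ = _ := by
        simp
        field_simp

/-- The bias of the visits, the term `C / m ^ 2` and the passage from `m` transitions to `n = m + 1`
samples are relative errors `O(1/m)`, uniform over the class because `δ ≤ π_i ≤ 1`. -/
theorem eventually_exists_stateRisk_le (hf : IsOrdinary f) (hδ0 : 0 < δ) (hδk : δ < 1 / k)
    (hk : 2 ≤ k) {ε : ℝ} (hε : 0 < ε) : ∀ᶠ n : ℕ in atTop,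
      ∃ Mhat : Estimator k n, ∀ P ∈ chainsAtLeast k δ, ∀ i,
        stateRisk (fDiv f) P Mhat i ≤
          (((1 + ε) * ((k - 1) * deriv (deriv f) 1 / (2 * n)) / P.stationary i : ℝ) : EReal) := by
  have hF := hf.deriv_two_pos
  have hk1 : (0 : ℝ) < k - 1 := by
    have : (2 : ℝ) ≤ k := by exact_mod_cast hk
    linarith
  obtain ⟨B, C, hB, hB0, h⟩ := exists_stateRisk_le hf hδ0 hδk hε
  set F := deriv (deriv f) 1
  refine eventually_atTop_of_succ ?_
  have hlim : Tendsto (fun m : ℕ => (1 + 1 / (m : ℝ)) * (B * (F / 2) * (k - 1)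
      * (1 + 1 / δ ^ 2 / (m : ℝ)) + |C| / (m : ℝ))) atTop
      (𝓝 ((1 + 0) * (B * (F / 2) * (k - 1) * (1 + 0) + 0))) :=
    ((tendsto_const_div_atTop_nhds_zero_nat 1).const_add 1).mul
      ((((tendsto_const_div_atTop_nhds_zero_nat _).const_add 1).const_mul _).add
        (tendsto_const_div_atTop_nhds_zero_nat _))
  have hlt : (1 + 0) * (B * (F / 2) * (k - 1) * (1 + 0) + 0) < (1 + ε) * ((k - 1) * F / 2) := by
    have : 0 < F / 2 * (k - 1) := by positivity
    nlinarith
  filter_upwards [h, hlim.eventually_lt_const hlt, eventually_gt_atTop 0] with m hm hm1 hm2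
  obtain ⟨Mhat, hMhat⟩ := hm
  refine ⟨Mhat, fun P hP i => (hMhat P hP i).trans (EReal.coe_le_coe_iff.2 ?_)⟩
  have hm0 : (0 : ℝ) < m := by exact_mod_cast hm2
  have hπ : δ ≤ P.stationary i := P.le_stationary fun a => hP a i
  have hπ1 : P.stationary i ≤ 1 := by
    rw [← P.sum_stationary]
    exact Finset.single_le_sum (fun j _ => P.stationary_nonneg j) (Finset.mem_univ i)
  set π := P.stationary i
  have hπ0 : 0 < π := hδ0.trans_le hπ
  have h1 : (m * π + 1 / δ) / (m * π) ^ 2 ≤ (1 + 1 / δ ^ 2 / m) / (m * π) := by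
    rw [div_le_div_iff₀ (by positivity) (by positivity)]
    have : 1 / δ ≤ 1 / δ ^ 2 * π := by
      rw [one_div_mul_eq_div, div_le_div_iff₀ hδ0 (by positivity)]
      nlinarith
    have e : (1 + 1 / δ ^ 2 / m) * (m * π) ^ 2 = (m * π + 1 / δ ^ 2 * π) * (m * π) := by
      field_simp
    rw [e]
    gcongr
  have h2 : C / m ^ 2 ≤ |C| / m / (m * π) := by
    rw [div_div, div_le_div_iff₀ (by positivity) (by positivity)]
    have h3 : C * (m * (m * π)) ≤ |C| * (m * (m * π)) := by
      gcongr
      exact le_abs_self C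
    have h4 : |C| * (m * (m * π)) ≤ |C| * (m * (m * 1)) := by gcongr
    linarith
  calc B * (F / 2) * ((k - 1) * (m * π + 1 / δ) / (m * π) ^ 2) + C / m ^ 2
      = B * (F / 2) * (k - 1) * ((m * π + 1 / δ) / (m * π) ^ 2) + C / m ^ 2 := by ring
    _ ≤ B * (F / 2) * (k - 1) * ((1 + 1 / δ ^ 2 / m) / (m * π)) + |C| / m / (m * π) := by gcongr
    _ = (1 + 1 / (m : ℝ)) * (B * (F / 2) * (k - 1) * (1 + 1 / δ ^ 2 / (m : ℝ)) + |C| / (m : ℝ))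
          / ((m + 1) * π) := by
        field_simp
    _ ≤ (1 + ε) * ((k - 1) * F / 2) / ((m + 1) * π) := by gcongr
    _ = _ := by
        push_cast
        field_simp

theorem eventually_minimaxWeightedRisk_le (hf : IsOrdinary f) (hδ0 : 0 < δ) (hδk : δ < 1 / k)
    (hk : 2 ≤ k) {ε : ℝ} (hε : 0 < ε) : ∀ᶠ n : ℕ in atTop,
      minimaxWeightedRisk f (chainsAtLeast k δ) n
        ≤ (((k - 1 : ℝ) * k * deriv (deriv f) 1 / (2 * n) * (1 + ε) : ℝ) : EReal) := by
  filter_upwards [eventually_exists_stateRisk_le hf hδ0 hδk hk hε] with n ⟨Mhat, h⟩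
  refine (iInf_le _ Mhat).trans (iSup₂_le fun P hP => ?_)
  refine (weightedRisk_le_coe_sum (h P hP)).trans (EReal.coe_le_coe_iff.2 (le_of_eq ?_))
  have : ∀ i, P.stationary i * ((1 + ε) * ((k - 1) * deriv (deriv f) 1 / (2 * n)) / P.stationary i)
      = (1 + ε) * ((k - 1) * deriv (deriv f) 1 / (2 * n)) := fun i =>
    mul_div_cancel₀ _ (hδ0.trans_le (P.le_stationary fun a => hP a i)).ne'
  simp only [this]
  simp
  ring

theorem eventually_minimaxMaxRisk_le (hf : IsOrdinary f) (hδ0 : 0 < δ) (hδk : δ < 1 / k)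
    (hk : 2 ≤ k) {ε : ℝ} (hε : 0 < ε) : ∀ᶠ n : ℕ in atTop,
      minimaxMaxRisk f (chainsAtLeast k δ) n
        ≤ (((k - 1 : ℝ) * deriv (deriv f) 1 / (2 * n * δ) * (1 + ε) : ℝ) : EReal) := by
  have hF := hf.deriv_two_pos
  have hk1 : (0 : ℝ) < k - 1 := by
    have : (2 : ℝ) ≤ k := by exact_mod_cast hk
    linarith
  filter_upwards [eventually_exists_stateRisk_le hf hδ0 hδk hk hε] with n ⟨Mhat, h⟩
  refine (iInf_le _ Mhat).trans (iSup₂_le fun P hP => iSup_le fun i => ?_)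
  refine (h P hP i).trans (EReal.coe_le_coe_iff.2 ?_)
  have hπ : δ ≤ P.stationary i := P.le_stationary fun a => hP a i
  calc _ ≤ (1 + ε) * ((k - 1) * deriv (deriv f) 1 / (2 * n)) / δ := by gcongr
    _ = _ := by rw [← div_div]; ring

end upperBound

/-! ### From `ε`-bounds to asymptotic comparison; the one-state case -/

section comparison

theorem asympLE_of_le {a b : ℕ → EReal} (h : ∀ᶠ n in atTop, a n ≤ b n) : AsympLE a b :=
  ⟨fun _ => 0, tendsto_const_nhds, by simpa using h⟩

/-- The error term is read off the ratio itself; `toReal` sends `⊥` to `0`, which the maximum with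
`0` makes harmless. -/
theorem asympLE_coe_of_forall {a : ℕ → EReal} {b : ℕ → ℝ} (hb : ∀ᶠ n in atTop, 0 < b n)
    (h : ∀ ε : ℝ, 0 < ε → ∀ᶠ n in atTop, a n ≤ ((b n * (1 + ε) : ℝ) : EReal)) :
    AsympLE a fun n => (b n : EReal) := by
  refine ⟨fun n => max 0 ((a n).toReal / b n - 1), ?_, ?_⟩
  · rw [Metric.tendsto_nhds]
    intro ε hε
    filter_upwards [hb, h (ε / 2) (half_pos hε)] with n hn h2
    rw [Real.dist_eq, sub_zero, abs_of_nonneg (le_max_left _ _), max_lt_iff]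
    refine ⟨hε, ?_⟩
    by_cases hbot : a n = ⊥
    · simp only [hbot, EReal.toReal_bot, zero_div]
      linarith
    have h3 : (a n).toReal ≤ b n * (1 + ε / 2) := by
      rw [← EReal.toReal_coe (b n * (1 + ε / 2))]
      exact EReal.toReal_le_toReal h2 hbot (EReal.coe_ne_top _)
    have : (a n).toReal / b n ≤ 1 + ε / 2 := by rwa [div_le_iff₀' hn]
    linarith
  · filter_upwards [hb, h 1 one_pos] with n hn h1
    have htop : a n ≠ ⊤ := fun ht => by
      rw [ht, top_le_iff] at h1
      exact EReal.coe_ne_top _ h1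
    refine (EReal.le_coe_toReal htop).trans ?_
    rw [← EReal.coe_mul, EReal.coe_le_coe_iff]
    have h2 : (a n).toReal / b n ≤ 1 + max 0 ((a n).toReal / b n - 1) := by
      linarith [le_max_right 0 ((a n).toReal / b n - 1)]
    rwa [div_le_iff₀' hn] at h2

theorem coe_asympLE_of_forall {a : ℕ → EReal} {b : ℕ → ℝ} (hb : ∀ᶠ n in atTop, 0 < b n)
    (h : ∀ ε : ℝ, 0 < ε → ε < 1 → ∀ᶠ n in atTop, (((1 - ε) * b n : ℝ) : EReal) ≤ a n) :
    AsympLE (fun n => (b n : EReal)) a := by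
  refine ⟨fun n => max 0 (b n / (a n).toReal - 1), ?_, ?_⟩
  · rw [Metric.tendsto_nhds]
    intro ε hε
    -- Chosen so that `(1 + ε)` times one minus this is `1 + ε / 2`.
    have hε' : 0 < ε / (2 * (1 + ε)) := by positivity
    have hε1 : ε / (2 * (1 + ε)) < 1 := by
      rw [div_lt_one (by positivity)]
      linarith
    filter_upwards [hb, h _ hε' hε1] with n hn h2
    rw [Real.dist_eq, sub_zero, abs_of_nonneg (le_max_left _ _), max_lt_iff]
    refine ⟨hε, ?_⟩
    by_cases htop : a n = ⊤
    · simp only [htop, EReal.toReal_top, div_zero]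
      linarith
    have h3 : (1 - ε / (2 * (1 + ε))) * b n ≤ (a n).toReal := by
      rw [← EReal.toReal_coe ((1 - ε / (2 * (1 + ε))) * b n)]
      exact EReal.toReal_le_toReal h2 (EReal.coe_ne_bot _) htop
    have h4 : 0 < (a n).toReal := lt_of_lt_of_le (mul_pos (by linarith) hn) h3
    rw [sub_lt_iff_lt_add, div_lt_iff₀ h4]
    have h5 : (ε + 1) * ((1 - ε / (2 * (1 + ε))) * b n) = (1 + ε / 2) * b n := by
      field_simp
      ring
    nlinarith [mul_le_mul_of_nonneg_left h3 (show 0 ≤ ε + 1 by linarith)]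
  · filter_upwards [hb, h (1 / 2) (by norm_num) (by norm_num)] with n hn h1
    by_cases htop : a n = ⊤
    · rw [htop, EReal.top_mul_coe_of_pos]
      · exact le_top
      · linarith [le_max_left 0 (b n / (⊤ : EReal).toReal - 1)]
    have hpos : 0 < (1 - 1 / 2) * b n := by linarith
    have hbot : a n ≠ ⊥ := fun ht => by
      rw [ht, le_bot_iff] at h1
      exact EReal.coe_ne_bot _ h1
    have h3 : (1 - 1 / 2) * b n ≤ (a n).toReal := by
      rw [← EReal.toReal_coe ((1 - 1 / 2) * b n)]
      exact EReal.toReal_le_toReal h1 (EReal.coe_ne_bot _) htop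
    conv_rhs => rw [← EReal.coe_toReal htop hbot]
    rw [← EReal.coe_mul, EReal.coe_le_coe_iff, EReal.toReal_coe]
    have h4 : 0 < (a n).toReal := hpos.trans_le h3
    have h2 : b n / (a n).toReal ≤ 1 + max 0 (b n / (a n).toReal - 1) := by
      linarith [le_max_right 0 (b n / (a n).toReal - 1)]
    rwa [div_le_iff₀' h4] at h2

theorem eq_one_of_mem_rowStochastic_one {M : Matrix (Fin 1) (Fin 1) ℝ}
    (hM : M ∈ Matrix.rowStochastic ℝ (Fin 1)) (i j : Fin 1) : M i j = 1 := by
  have := Matrix.sum_row_of_mem_rowStochastic hM i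
  rw [Subsingleton.elim j 0]
  simpa using this

theorem stateRisk_one_state {f : ℝ → ℝ} (hf : f 1 = 0) {n : ℕ} (P : MarkovChain 1)
    (Mhat : Estimator 1 n) (i : Fin 1) : stateRisk (fDiv f) P Mhat i = 0 := by
  unfold stateRisk fDiv fDivTerm
  simp [eq_one_of_mem_rowStochastic_one P.trans_mem,
    eq_one_of_mem_rowStochastic_one (Subtype.prop (Mhat _)), hf]

theorem minimax_eq_zero_of_one_state {δ : ℝ} (hδ : δ ≤ 1) {n : ℕ}
    {risk : MarkovChain 1 → Estimator 1 n → EReal} (h : ∀ P Mhat, risk P Mhat = 0) :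
    minimax risk (chainsAtLeast 1 δ) = 0 := by
  have hone : (1 : Matrix (Fin 1) (Fin 1) ℝ) ∈ Matrix.rowStochastic ℝ (Fin 1) := one_mem _
  have : Nonempty (Estimator 1 n) := ⟨fun _ => ⟨1, hone⟩⟩
  have hne : (chainsAtLeast 1 δ).Nonempty :=
    ⟨⟨fun _ => 1, 1, ⟨fun _ => zero_le_one, by simp⟩, hone⟩, fun i j =>
      hδ.trans (eq_one_of_mem_rowStochastic_one hone i j).ge⟩
  unfold minimax
  simp only [h, biSup_const hne, ciInf_const]

end comparison

theorem theorem2 (f : ℝ → ℝ) (hf : IsOrdinary f) (k : ℕ) (δ : ℝ)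
    (hδ : δ ∈ Set.Ioo (0 : ℝ) (1 / (k : ℝ))) :
    AsympEq (fun n => minimaxWeightedRisk f (chainsAtLeast k δ) n)
      (fun n => (((k - 1 : ℝ) * k * deriv (deriv f) 1 / (2 * n) : ℝ) : EReal)) ∧
    AsympLE (fun n => (((1 - δ) * ((k - 2 : ℝ) * deriv (deriv f) 1 / (2 * n * δ)) : ℝ) : EReal))
      (fun n => minimaxMaxRisk f (chainsAtLeast k δ) n) ∧
    AsympLE (fun n => minimaxMaxRisk f (chainsAtLeast k δ) n)
      (fun n => (((k - 1 : ℝ) * deriv (deriv f) 1 / (2 * n * δ) : ℝ) : EReal)) := by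
  obtain ⟨hδ0, hδk⟩ := hδ
  have hF := hf.deriv_two_pos
  obtain rfl | rfl | hk : k = 0 ∨ k = 1 ∨ 2 ≤ k := by omega
  -- Here `1 / k` is `1 / 0 = 0`, so no `δ` qualifies.
  · norm_num at hδk
    linarith
  · have hδ1 : δ < 1 := by simpa using hδk
    have hw : ∀ n, minimaxWeightedRisk f (chainsAtLeast 1 δ) n = 0 := fun n =>
      minimax_eq_zero_of_one_state hδ1.le fun P Mhat => by
        simp [weightedRisk, stateRisk_one_state hf.map_one]
    have hm : ∀ n, minimaxMaxRisk f (chainsAtLeast 1 δ) n = 0 := fun n =>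
      minimax_eq_zero_of_one_state hδ1.le fun P Mhat => by
        simp [maxRisk, stateRisk_one_state hf.map_one]
    simp only [hw, hm]
    refine ⟨⟨asympLE_of_le ?_, asympLE_of_le ?_⟩, asympLE_of_le ?_, asympLE_of_le ?_⟩
    · simp
    · simp
    -- For one state all risks vanish, and the lower bound is nonpositive because `k - 2 = -1`.
    · refine Eventually.of_forall fun n => EReal.coe_nonpos.2 ?_
      refine mul_nonpos_of_nonneg_of_nonpos (by linarith) ?_
      refine div_nonpos_of_nonpos_of_nonneg ?_ (by positivity)
      push_cast
      linarith
    · simp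
  have hk1 : (0 : ℝ) < k - 1 := by
    have : (2 : ℝ) ≤ k := by exact_mod_cast hk
    linarith
  have hk0 : (0 : ℝ) < k := by linarith
  have hbw : ∀ᶠ n : ℕ in atTop, 0 < (k - 1 : ℝ) * k * deriv (deriv f) 1 / (2 * n) := by
    filter_upwards [eventually_gt_atTop 0] with n hn
    have : (0 : ℝ) < n := by exact_mod_cast hn
    positivity
  have hbm : ∀ᶠ n : ℕ in atTop, 0 < (k - 1 : ℝ) * deriv (deriv f) 1 / (2 * n * δ) := by
    filter_upwards [eventually_gt_atTop 0] with n hn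
    have : (0 : ℝ) < n := by exact_mod_cast hn
    positivity
  exact ⟨⟨asympLE_coe_of_forall hbw fun ε hε => eventually_minimaxWeightedRisk_le hf hδ0 hδk hk hε,
      coe_asympLE_of_forall hbw fun ε hε hε1 =>
        eventually_minimaxWeightedRisk_ge hf hδ0 hδk hk hε hε1⟩,
    asympLE_of_le (eventually_minimaxMaxRisk_ge hf hδ0 hδk hk),
    asympLE_coe_of_forall hbm fun ε hε => eventually_minimaxMaxRisk_le hf hδ0 hδk hk hε⟩
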